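/- Let $\mathbb{R}^3_1$ be $\mathbb{R}^3$ with the Lorentzian metric $\langle\,,\rangle=dx_1^2+dx_2^2-dx_3^2$, and let $\pi_0:\mathbb{R}^3\to\{x_3=0\}\equiv\mathbb{C}$ be the orthogonal projection. Let $\mathcal{M}$ be a connected Riemann surface with boundary: a closed connected subset of a Riemann surface $\mathcal{M}'$ without boundary, together with a set $\partial\mathcal{M}\subset\mathcal{M}$ which contains the topological frontier of $\mathcal{M}$ in $\mathcal{M}'$ and is the union of a locally finite family of pairwise disjoint sets, each being a piecewise $\mathcal{C}^1$ simple loop or properly embedded line contained in the frontier, or a single point; the interior $\mathrm{Int}(\mathcal{M})=\mathcal{M}\setminus\partial\mathcal{M}$ is dense in $\mathcal{M}$. Assume $\partial\mathcal{M}\neq\emptyset$. Let $X:\mathcal{M}\to\mathbb{R}^3_1$ be a proper conformal maximal immersion, that is, a proper map which is the restriction of a smooth map $\mathcal{M}'\to\mathbb{R}^3_1$ and which on $\mathrm{Int}(\mathcal{M})$ is spacelike (the induced metric is Riemannian), conformal and of zero mean curvature; points of $\partial\mathcal{M}$ are allowed to be singular. Suppose that $X(\mathcal{M})$ is the graph $\{(z,u(z))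 : z\in\Omega\}$ of a real function $u$ on a closed set $\Omega\subset\{x_3=0\}\equiv\mathbb{C}$ which is starlike with respect to $\pi_0(X(p_0))$ for some $p_0\in\mathrm{Int}(\mathcal{M})$. Then $\mathcal{M}$ is relative parabolic: every bounded continuous function on $\mathcal{M}$ that is harmonic on $\mathrm{Int}(\mathcal{M})$ and vanishes on $\partial\mathcal{M}$ is identically zero. -/

import Mathlib

open scoped Manifold ContDiff

namespace MaximalSurface

/-- The vector space underlying the Lorentz-Minkowski space `ℝ³₁`. -/
abbrev E3 : Type := EuclideanSpace ℝ (Fin 3)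

/-- The Lorentzian metric `dx₁² + dx₂² - dx₃²`. -/
def lorentz (x y : E3) : ℝ := x 0 * y 0 + x 1 * y 1 - x 2 * y 2

/-- The orthogonal projection onto the plane `{x₃ = 0}`, which is identified with `ℂ`. -/
def proj₀ (x : E3) : ℂ := ⟨x 0, x 1⟩

section Curves

variable {R : Type*} [TopologicalSpace R] [ChartedSpace ℂ R]

/-- A piecewise `C¹` curve: near every parameter `t` it is `C¹` on some `[t - ε, t]` and on
`[t, t + ε]`. (So it is continuous, and every compact interval splits into finitely many closed
intervals on which the curve is `C¹`.) -/
def PiecewiseC1 (c : ℝ → R) : Prop :=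
  ∀ t : ℝ, ∃ ε > 0,
    ContMDiffOn 𝓘(ℝ, ℝ) 𝓘(ℝ, ℂ) 1 c (Set.Icc (t - ε) t) ∧
    ContMDiffOn 𝓘(ℝ, ℝ) 𝓘(ℝ, ℂ) 1 c (Set.Icc t (t + ε))

/-- The trace of a piecewise `C¹` simple loop. -/
def IsSimpleLoop (Γ : Set R) : Prop :=
  ∃ c : ℝ → R, PiecewiseC1 c ∧ Function.Periodic c 1 ∧ Set.InjOn c (Set.Ico 0 1) ∧ Set.range c = Γ

/-- The trace of a properly embedded piecewise `C¹` line. -/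
def IsProperLine (Γ : Set R) : Prop :=
  ∃ c : ℝ → R, PiecewiseC1 c ∧ Topology.IsClosedEmbedding c ∧ Set.range c = Γ

end Curves

/-- A connected Riemann surface with (possibly empty) boundary, sitting as a closed subset
`carrier` in a Riemann surface `R` without boundary. The boundary is a locally finite union of
pairwise disjoint members, each of which is a piecewise `C¹` simple loop or properly embedded line
in the topological frontier, or a single point. It contains the whole frontier; a
single-point member may be a point around which `carrier` is a full neighbourhood. -/
structure BorderedSurface (R : Type*) [TopologicalSpace R] [ChartedSpace ℂ R] where
  carrier : Set R
  boundary : Set R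
  isClosed : IsClosed carrier
  isConnected : IsConnected carrier
  boundary_subset : boundary ⊆ carrier
  frontier_subset : frontier carrier ⊆ boundary
  interior_dense : carrier ⊆ closure (carrier \ boundary)
  boundary_curves : ∃ 𝒞 : Set (Set R), 𝒞.PairwiseDisjoint id ∧
    LocallyFinite (fun Γ : 𝒞 => (Γ : Set R)) ∧ ⋃₀ 𝒞 = boundary ∧
    ∀ Γ ∈ 𝒞, (∃ p, Γ = {p}) ∨ ((IsSimpleLoop Γ ∨ IsProperLine Γ) ∧ Γ ⊆ frontier carrier)

section Surfaces

variable {R : Type*} [TopologicalSpace R] [ChartedSpace ℂ R]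

/-- `Int(M) = M - ∂M`. -/
def BorderedSurface.int (M : BorderedSurface R) : Set R := M.carrier \ M.boundary

/-- `f` is harmonic on `U`: it is so in every local holomorphic coordinate. -/
def HarmonicOnSurface (f : R → ℝ) (U : Set R) : Prop :=
  ∀ e ∈ atlas ℂ R,
    InnerProductSpace.HarmonicOnNhd (f ∘ e.symm) (e.target ∩ e.symm ⁻¹' U)

/-- Relative parabolicity: a bounded function that is continuous on `M`, harmonic on `Int(M)` and
zero on `∂M` vanishes identically on `M`. -/
def BorderedSurface.RelativeParabolic (M : BorderedSurface R) : Prop :=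
  ∀ f : R → ℝ, ContinuousOn f M.carrier → HarmonicOnSurface f M.int →
    (∃ C : ℝ, ∀ p ∈ M.carrier, |f p| ≤ C) → (∀ p ∈ M.boundary, f p = 0) →
    ∀ p ∈ M.carrier, f p = 0

end Surfaces

section Parametrized

/-! Local geometry of a parametrized surface `Y(u + i v)` in `ℝ³₁`. -/

/-- The first derivative of `Y` in the direction `a`; `Y_u` is `a = 1`, `Y_v` is `a = i`. -/
noncomputable def D (Y : ℂ → E3) (a : ℂ) (z : ℂ) : E3 := fderiv ℝ Y z a

/-- The induced metric on the parameter domain. -/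
noncomputable def firstForm (Y : ℂ → E3) (z a b : ℂ) : ℝ := lorentz (D Y a z) (D Y b z)

/-- The second fundamental form with respect to the normal vector `N`. -/
noncomputable def secondForm (Y : ℂ → E3) (N : E3) (z a b : ℂ) : ℝ :=
  lorentz (D (D Y b) a z) N

/-- The induced metric is Riemannian at `z`. -/
def SpacelikeAt (Y : ℂ → E3) (z : ℂ) : Prop := ∀ a : ℂ, a ≠ 0 → 0 < firstForm Y z a a

/-- The induced metric at `z` is a multiple of `du² + dv²`. -/
def IsothermalAt (Y : ℂ → E3) (z : ℂ) : Prop :=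
  firstForm Y z 1 1 = firstForm Y z Complex.I Complex.I ∧ firstForm Y z 1 Complex.I = 0

/-- `N` is a unit (timelike) normal of `Y` at `z`. -/
def IsUnitNormal (Y : ℂ → E3) (z : ℂ) (N : E3) : Prop :=
  lorentz N N = -1 ∧ ∀ a : ℂ, lorentz (D Y a z) N = 0

/-- The mean curvature with respect to `N`: half the trace of the second fundamental form with
respect to the first one. -/
noncomputable def meanCurvature (Y : ℂ → E3) (N : E3) (z : ℂ) : ℝ :=
  (secondForm Y N z 1 1 * firstForm Y z Complex.I Complex.I
      - 2 * secondForm Y N z 1 Complex.I * firstForm Y z 1 Complex.I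
      + secondForm Y N z Complex.I Complex.I * firstForm Y z 1 1) /
    (2 * (firstForm Y z 1 1 * firstForm Y z Complex.I Complex.I - firstForm Y z 1 Complex.I ^ 2))

end Parametrized

/-- A conformal maximal immersion of the bordered surface `M`: the restriction to `M` of a smooth
map of the ambient surface, which on `Int(M)` is spacelike, conformal and of zero mean curvature.
Nothing is required of the induced metric at boundary points. -/
structure IsConformalMaximalImmersion {R : Type*} [TopologicalSpace R] [ChartedSpace ℂ R]
    (M : BorderedSurface R) (X : R → E3) : Prop where
  smooth : ContMDiff 𝓘(ℝ, ℂ) 𝓘(ℝ, E3) ∞ X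
  spacelike : ∀ e ∈ atlas ℂ R, ∀ z ∈ e.target, e.symm z ∈ M.int → SpacelikeAt (X ∘ e.symm) z
  conformal : ∀ e ∈ atlas ℂ R, ∀ z ∈ e.target, e.symm z ∈ M.int → IsothermalAt (X ∘ e.symm) z
  maximal : ∀ e ∈ atlas ℂ R, ∀ z ∈ e.target, e.symm z ∈ M.int →
    ∀ N : E3, IsUnitNormal (X ∘ e.symm) z N → meanCurvature (X ∘ e.symm) N z = 0

/-- `S ⊆ ℝ³₁` is the graph of a real function on `Ω ⊆ {x₃ = 0}`. -/
def IsGraphOver (S : Set E3) (Ω : Set ℂ) : Prop :=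
  ∃ u : ℂ → ℝ, S = {x : E3 | proj₀ x ∈ Ω ∧ x 2 = u (proj₀ x)}

end MaximalSurface

/-!
Away from the projection of `X(∂M)` the height `u` is locally contracting, because `X` is spacelike.
Since `X(∂M)` has dimension at most `1 < 2`, on almost every ray from `z₀ = π₀(X(p₀))` the
functions `±u - |z - z₀|` map the exceptional points to a null set, which makes them decreasing, so
`u` is `1`-Lipschitz along the ray; closedness of the graph rules out jumps and blow-up. As `u` is
strictly contracting near `z₀`, this keeps `X - X(p₀)`, off a compact set, outside the light cone
and at vertical distance at least some `δ > 0` from it.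

The coordinates of a conformal maximal immersion are harmonic, so `⟨X - X(p₀), X - X(p₀)⟩` is
subharmonic; composed with `t ↦ log (1 + log (t / δ²))` it becomes a nonnegative, proper, strictly
superharmonic barrier where `X - X(p₀)` lies in that region. A Phragmén–Lindelöf argument bounds a
harmonic function by its values on `∂M` and on the compact set, and the strong maximum principle
removes the compact set.
-/

namespace MaximalSurface

open Set Filter Topology MeasureTheory Bornology Complex InnerProductSpace
open scoped NNReal Interval Laplacian

section ClosedGraph

theorem le_of_frequently_le_of_null_image {F : ℝ → ℝ} {a b : ℝ} {S : Set ℝ} (hab : a ≤ b)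
    (hF : ContinuousOn F (Icc a b))
    (hloc : ∀ t ∈ Ico a b, t ∉ S → ∃ᶠ s in 𝓝[>] t, F s ≤ F t)
    (hnull : volume (F '' S) = 0) : F b ≤ F a := by
  by_contra! hlt
  obtain ⟨y, ⟨hay, hyb⟩, hyS⟩ : ∃ y ∈ Ioo (F a) (F b), y ∉ F '' S := by
    by_contra! hsub
    have hvol : volume (Ioo (F a) (F b)) = 0 := measure_mono_null hsub hnull
    rw [Real.volume_Ioo, ENNReal.ofReal_eq_zero] at hvol
    linarith
  have hcompact : IsCompact (Icc a b ∩ F ⁻¹' Iic y) :=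
    isCompact_Icc.of_isClosed_subset
      (hF.preimage_isClosed_of_isClosed isClosed_Icc isClosed_Iic) inter_subset_left
  obtain ⟨t, ⟨ht, hty⟩, htmax⟩ := hcompact.exists_isGreatest ⟨a, left_mem_Icc.2 hab, hay.le⟩
  have htb : t < b := lt_of_le_of_ne ht.2 (by rintro rfl; exact absurd hty (not_le.2 hyb))
  have hright : ∀ᶠ s in 𝓝[>] t, y < F s := by
    filter_upwards [Ioo_mem_nhdsGT htb] with s hs
    by_contra! hsy
    exact absurd (htmax ⟨⟨ht.1.trans hs.1.le, hs.2.le⟩, hsy⟩) (not_le.2 hs.1)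
  have hcont : Tendsto F (𝓝[>] t) (𝓝 (F t)) := by
    refine (hF t ht).mono_left ?_
    rw [← nhdsWithin_Ioo_eq_nhdsGT htb]
    exact nhdsWithin_mono _ fun s hs => ⟨ht.1.trans hs.1.le, hs.2.le⟩
  have hFt : F t = y := le_antisymm hty (ge_of_tendsto hcont (hright.mono fun _ h => h.le))
  obtain ⟨s, hst, hys⟩ :=
    ((hloc t ⟨ht.1, htb⟩ fun h => hyS ⟨t, h, hFt⟩).and_eventually hright).exists
  linarith

theorem isClosed_inter_preimage_of_isClosed_graphOn {α β : Type*} [TopologicalSpace α]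
    [TopologicalSpace β] {f : α → β} {s : Set α} (h : IsClosed (s.graphOn f)) {k : Set β}
    (hk : IsCompact k) : IsClosed (s ∩ f ⁻¹' k) := by
  have : CompactSpace k := isCompact_iff_compactSpace.1 hk
  convert isClosedMap_fst_of_compactSpace _
    (h.preimage (continuous_id.prodMap (continuous_subtype_val (p := (· ∈ k))))) using 1
  ext x
  simp [eq_comm]

theorem continuousOn_of_isClosed_graphOn {α β : Type*} [TopologicalSpace α]
    [TopologicalSpace β] {f : α → β} {s t : Set α} (h : IsClosed (s.graphOn f)) (hts : t ⊆ s)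
    {k : Set β} (hk : IsCompact k) (htk : MapsTo f t k) : ContinuousOn f t := by
  refine continuousOn_iff_isClosed.2 fun c hc =>
    ⟨_, isClosed_inter_preimage_of_isClosed_graphOn h (hk.inter_right hc), ?_⟩
  ext x
  exact ⟨fun hx => ⟨⟨hts hx.2, htk hx.2, hx.1⟩, hx.2⟩, fun hx => ⟨hx.1.2.2, hx.2⟩⟩

variable {E : Type*} [PseudoMetricSpace E] {g : ℝ → E} {I : Set ℝ} {K : ℝ≥0}

/-- The points of `I` near which `g` is unbounded on `I`. -/
def unboundedPoints (g : ℝ → E) (I : Set ℝ) : Set ℝ :=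
  {t ∈ I | ∀ W ∈ 𝓝[I] t, ¬ IsBounded (g '' W)}

theorem isClosed_unboundedPoints (hI : IsClosed I) : IsClosed (unboundedPoints g I) := by
  refine isClosed_of_closure_subset fun t ht => ⟨hI.closure_subset_iff.2 (fun _ h => h.1) ht,
    fun W hW hbdd => ?_⟩
  obtain ⟨V, hVo, htV, hVW⟩ := mem_nhdsWithin.1 hW
  obtain ⟨s, hsV, -, hs⟩ := mem_closure_iff.1 ht V hVo htV
  exact hs W (mem_nhdsWithin.2 ⟨V, hVo, hsV, hVW⟩) hbdd

theorem isBounded_image_of_disjoint_unboundedPoints {C : Set ℝ} (hC : IsCompact C) (hCI : C ⊆ I)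
    (hdisj : Disjoint C (unboundedPoints g I)) : IsBounded (g '' C) := by
  refine hC.induction_on (p := fun A => IsBounded (g '' A)) (by simp)
    (fun A B hAB hB => hB.subset (image_mono hAB))
    (fun A B hA hB => by rw [image_union]; exact hA.union hB) fun t ht => ?_
  by_contra! hunb
  exact disjoint_left.1 hdisj ht ⟨hCI ht, fun W hW => hunb W (nhdsWithin_mono t hCI hW)⟩

theorem dist_le_of_isBounded_image_uIcc_of_ne (hIconn : I.OrdConnected)
    (hLip : ∀ c ∈ I, ∀ d ∈ I, IsBounded (g '' [[c, d]]) → dist (g c) (g d) ≤ K * dist c d)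
    {c d : ℝ} (hc : c ∈ I) (hd : d ∈ I)
    (hbdd : ∀ s ∈ [[c, d]], s ≠ c → IsBounded (g '' [[s, d]])) :
    dist (g c) (g d) ≤ K * dist c d := by
  refine hLip c hc d hd ((isBounded_singleton.union Metric.isBounded_closedBall).subset
    (t := {g c} ∪ Metric.closedBall (g d) (K * dist c d)) ?_)
  rintro _ ⟨s, hs, rfl⟩
  rcases eq_or_ne s c with rfl | hsc
  · exact Or.inl rfl
  · refine Or.inr ((hLip s (hIconn.uIcc_subset hc hd hs) d hd (hbdd s hs hsc)).trans ?_)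
    gcongr
    exact Real.dist_right_le_of_mem_uIcc hs

theorem exists_mem_unboundedPoints_dist_le (hIconn : I.OrdConnected) (hI : IsClosed I)
    (hLip : ∀ c ∈ I, ∀ d ∈ I, IsBounded (g '' [[c, d]]) → dist (g c) (g d) ≤ K * dist c d)
    {t t₀ : ℝ} (ht : t ∈ I) (ht₀ : t₀ ∈ unboundedPoints g I) :
    ∃ e ∈ unboundedPoints g I ∩ [[t₀, t]], dist (g e) (g t) ≤ K * dist e t := by
  obtain ⟨e, ⟨heD, het⟩, hmin⟩ :=
    ((isCompact_uIcc (a := t₀) (b := t)).inter_left (isClosed_unboundedPoints hI)).exists_isMinOn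
      ⟨t₀, ht₀, left_mem_uIcc⟩ (f := fun s => dist s t) (by fun_prop)
  refine ⟨e, ⟨heD, het⟩,
    dist_le_of_isBounded_image_uIcc_of_ne hIconn hLip heD.1 ht fun s hs hse => ?_⟩
  have hsI : [[s, t]] ⊆ I := hIconn.uIcc_subset (hIconn.uIcc_subset heD.1 ht hs) ht
  refine isBounded_image_of_disjoint_unboundedPoints isCompact_uIcc hsI
    (disjoint_left.2 fun r hr hrD => ?_)
  have hrt : dist e t ≤ dist r t := hmin ⟨hrD,
    uIcc_subset_uIcc het right_mem_uIcc (uIcc_subset_uIcc hs right_mem_uIcc hr)⟩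
  have hes : dist e t ≤ dist s t := hrt.trans (Real.dist_right_le_of_mem_uIcc hr)
  refine hse ?_
  rcases le_total e t with h | h
  · rw [uIcc_of_le h] at hs
    rw [Real.dist_eq, Real.dist_eq, abs_of_nonpos (by linarith), abs_of_nonpos (by linarith [hs.2])]
      at hes
    linarith [hs.1]
  · rw [uIcc_of_ge h] at hs
    rw [Real.dist_eq, Real.dist_eq, abs_of_nonneg (by linarith), abs_of_nonneg (by linarith [hs.1])]
      at hes
    linarith [hs.2]

theorem unboundedPoints_eq_empty [ProperSpace E] (hIconn : I.OrdConnected) (hI : IsClosed I)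
    (hgraph : IsClosed (I.graphOn g))
    (hLip : ∀ c ∈ I, ∀ d ∈ I, IsBounded (g '' [[c, d]]) → dist (g c) (g d) ≤ K * dist c d) :
    unboundedPoints g I = ∅ := by
  by_contra! hne
  obtain ⟨x₀, hx₀⟩ := hne
  set U := unboundedPoints g I
  have : Nonempty U := ⟨⟨x₀, hx₀⟩⟩
  have : CompleteSpace U := (isClosed_unboundedPoints hI).completeSpace_coe
  have hclosed (n : ℕ) : IsClosed {t : U | dist (g t) (g x₀) ≤ n} := by
    convert (isClosed_inter_preimage_of_isClosed_graphOn hgraph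
      (isCompact_closedBall (g x₀) n)).preimage (continuous_subtype_val (p := (· ∈ U))) using 1
    ext t
    exact (and_iff_right t.2.1).symm
  obtain ⟨n, ⟨t₀, ht₀⟩, htn⟩ := nonempty_interior_of_iUnion_of_closed hclosed
    (by ext t; simpa using exists_nat_ge (dist (g t) (g x₀)))
  obtain ⟨η, hη, hball⟩ := Metric.mem_nhds_iff.1 (mem_interior_iff_mem_nhds.1 htn)
  refine ht₀.2 (I ∩ Metric.ball t₀ η) (inter_mem_nhdsWithin _ (Metric.ball_mem_nhds t₀ hη))
    ((Metric.isBounded_closedBall (x := g x₀) (r := K * η + n)).subset ?_)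
  rintro _ ⟨t, ⟨htI, htη⟩, rfl⟩
  obtain ⟨e, ⟨heU, het⟩, hle⟩ := exists_mem_unboundedPoints_dist_le hIconn hI hLip htI ht₀
  have hdist : dist e t ≤ dist t₀ t ∧ dist e t₀ ≤ dist t t₀ :=
    ⟨Real.dist_right_le_of_mem_uIcc het, by
      simpa only [dist_comm] using Real.dist_left_le_of_mem_uIcc het⟩
  have hen : dist (g e) (g x₀) ≤ n :=
    @hball ⟨e, heU⟩ (Metric.mem_ball.2 (hdist.2.trans_lt htη))
  have hget : dist (g t) (g e) ≤ K * η := by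
    rw [dist_comm]
    refine hle.trans ?_
    gcongr
    exact hdist.1.trans (by rw [dist_comm]; exact (Metric.mem_ball.1 htη).le)
  exact (dist_triangle _ (g e) _).trans (add_le_add hget hen)

theorem lipschitzOnWith_of_isClosed_graphOn [ProperSpace E] (hIconn : I.OrdConnected)
    (hI : IsClosed I) (hgraph : IsClosed (I.graphOn g))
    (hLip : ∀ c ∈ I, ∀ d ∈ I, IsBounded (g '' [[c, d]]) → dist (g c) (g d) ≤ K * dist c d) :
    LipschitzOnWith K g I := by
  refine lipschitzOnWith_iff_dist_le_mul.2 fun c hc d hd => hLip c hc d hd ?_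
  refine isBounded_image_of_disjoint_unboundedPoints isCompact_uIcc (hIconn.uIcc_subset hc hd) ?_
  rw [unboundedPoints_eq_empty hIconn hI hgraph hLip]
  exact disjoint_empty _

theorem dist_le_of_locally_lipschitz_off_null {g : ℝ → ℝ} {a b : ℝ} {S : Set ℝ} (hab : a ≤ b)
    (hg : ContinuousOn g (Icc a b))
    (hloc : ∀ t ∈ Ico a b, t ∉ S → ∃ᶠ s in 𝓝[>] t, dist (g s) (g t) ≤ K * dist s t)
    (hnull : ∀ ε : ℝ, |ε| = 1 → volume ((fun t => ε * g t - K * t) '' S) = 0) :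
    dist (g a) (g b) ≤ K * dist a b := by
  have hone_sided {ε : ℝ} (hε : |ε| = 1) : ε * g b - K * b ≤ ε * g a - K * a := by
    refine le_of_frequently_le_of_null_image (F := fun t => ε * g t - K * t) hab (by fun_prop)
      (fun t ht htS => ((hloc t ht htS).and_eventually self_mem_nhdsWithin).mono ?_) (hnull ε hε)
    rintro s ⟨hs, hts⟩
    have hε' : ε * (g s - g t) ≤ dist (g s) (g t) := by
      rw [Real.dist_eq, ← one_mul |g s - g t|, ← hε, ← abs_mul]
      exact le_abs_self _
    rw [Real.dist_eq s, abs_of_pos (sub_pos.2 hts)] at hs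
    linarith
  have hpos := hone_sided (ε := 1) (by norm_num)
  have hneg := hone_sided (ε := -1) (by norm_num)
  rw [Real.dist_eq, Real.dist_eq, abs_sub_comm a b, abs_of_nonneg (sub_nonneg.2 hab)]
  exact abs_le.2 ⟨by linarith, by linarith⟩

theorem lipschitzOnWith_of_locally_lipschitz_off_null {g : ℝ → ℝ} {S : Set ℝ}
    (hIconn : I.OrdConnected) (hI : IsClosed I) (hgraph : IsClosed (I.graphOn g))
    (hloc : ∀ t ∈ I, t ∉ S → ∃ᶠ s in 𝓝[>] t, dist (g s) (g t) ≤ K * dist s t)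
    (hnull : ∀ ε : ℝ, |ε| = 1 → volume ((fun t => ε * g t - K * t) '' S) = 0) :
    LipschitzOnWith K g I := by
  refine lipschitzOnWith_of_isClosed_graphOn hIconn hI hgraph fun c hc d hd hbdd => ?_
  wlog hcd : c ≤ d generalizing c d
  · rw [dist_comm (g c), dist_comm c]
    exact this d hd c hc (by rwa [uIcc_comm]) (le_of_not_ge hcd)
  have hsub : Icc c d ⊆ I := hIconn.out hc hd
  have hcont : ContinuousOn g (Icc c d) :=
    continuousOn_of_isClosed_graphOn hgraph hsub hbdd.isCompact_closure fun t ht =>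
      subset_closure ⟨t, by rwa [uIcc_of_le hcd], rfl⟩
  exact dist_le_of_locally_lipschitz_off_null hcd hcont
    (fun t ht => hloc t (hsub ⟨ht.1, ht.2.le⟩)) hnull

end ClosedGraph

section StarConvex

theorem ae_volume_image_slice_eq_zero {X : Type*} [EMetricSpace X] [SecondCountableTopology X]
    {A : Set X} {p f : X → ℝ} (hA : dimH A < 2)
    (hpf : ∀ x ∈ A, ∃ C, ∃ t ∈ 𝓝[A] x, LipschitzOnWith C (fun x => (p x, f x)) t) :
    ∀ᵐ σ : ℝ, volume (f '' {x ∈ A | p x = σ}) = 0 := by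
  have hdim : dimH ((fun x => (p x, f x)) '' A) < (2 : ℝ≥0) :=
    (dimH_image_le_of_locally_lipschitzOn hpf).trans_lt hA
  have hnull : (volume : Measure (ℝ × ℝ)) ((fun x => (p x, f x)) '' A) = 0 := by
    rw [← hausdorffMeasure_prod_real]
    exact_mod_cast hausdorffMeasure_of_dimH_lt hdim
  filter_upwards [Measure.measure_ae_null_of_prod_null hnull] with σ hσ
  refine measure_mono_null ?_ hσ
  rintro _ ⟨x, ⟨hxA, rfl⟩, rfl⟩
  exact ⟨x, hxA, rfl⟩

theorem ae_volume_image_ray_eq_zero {A : Set (ℂ × ℝ)} (hA : dimH A < 2) (z₀ : ℂ) {ζ : ℂ}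
    (hζ : ζ ≠ 0) (ε : ℝ) :
    ∀ᵐ σ : ℝ, volume ((fun x : ℂ × ℝ => ε * x.2 - ‖x.1 - z₀‖) ''
      {x ∈ A | ∃ r : ℝ, 0 < r ∧ x.1 = z₀ + r • ((1 + σ * I) * ζ)}) = 0 := by
  -- In the coordinate `(x.1 - z₀) / ζ` the ray is the half-line of slope `σ` in `{0 < re}`.
  set w : ℂ × ℝ → ℂ := fun x => (x.1 - z₀) / ζ
  set B : Set (ℂ × ℝ) := {x ∈ A | 0 < (w x).re}
  have hslice := ae_volume_image_slice_eq_zero (A := B) (p := fun x => (w x).im / (w x).re)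
    (f := fun x => ε * x.2 - ‖x.1 - z₀‖) ((dimH_mono (sep_subset _ _)).trans_lt hA) fun x hx => by
      have hw : ContDiff ℝ 1 w := (contDiff_fst.sub contDiff_const).div_const ζ
      have hne : x.1 - z₀ ≠ 0 := fun h => by simpa [w, h] using hx.2
      have hdiff : ContDiffAt ℝ 1
          (fun x : ℂ × ℝ => ((w x).im / (w x).re, ε * x.2 - ‖x.1 - z₀‖)) x :=
        ((imCLM.contDiff.comp hw).contDiffAt.div (reCLM.contDiff.comp hw).contDiffAt
          hx.2.ne').prodMk ((contDiffAt_const.mul contDiffAt_snd).sub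
            ((contDiffAt_fst.sub contDiffAt_const).norm ℝ hne))
      obtain ⟨C, t, ht, hC⟩ := hdiff.exists_lipschitzOnWith
      exact ⟨C, t, mem_nhdsWithin_of_mem_nhds ht, hC⟩
  filter_upwards [hslice] with σ hσ
  refine measure_mono_null (image_mono ?_) hσ
  rintro x ⟨hxA, r, hr, hxr⟩
  have hwx : w x = r + (r * σ : ℝ) * I := by
    simp only [w, hxr, real_smul, add_sub_cancel_left]
    field_simp
    push_cast
    ring
  have hre : (w x).re = r := by simp [hwx]
  have him : (w x).im = r * σ := by simp [hwx]
  exact ⟨⟨hxA, hre ▸ hr⟩, by rw [hre, him, mul_div_cancel_left₀ _ hr.ne']⟩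

variable {u : ℂ → ℝ} {Ω U : Set ℂ} {z₀ v : ℂ} {t : ℝ}

theorem lipschitzOnWith_ray (hgraph : IsClosed (Ω.graphOn u))
    (hloc : ∀ ζ ∈ U, ∀ᶠ ξ in 𝓝 ζ, dist (u ξ) (u ζ) ≤ dist ξ ζ) (ht : 0 < t)
    (hseg : ∀ r ∈ Icc t 1, z₀ + r • v ∈ Ω)
    (hnull : ∀ ε : ℝ, |ε| = 1 → volume ((fun x : ℂ × ℝ => ε * x.2 - ‖x.1 - z₀‖) ''
      {x ∈ (Ω \ U).graphOn u | ∃ r : ℝ, 0 < r ∧ x.1 = z₀ + r • v}) = 0) :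
    LipschitzOnWith ‖v‖₊ (fun r : ℝ => u (z₀ + r • v)) (Icc t 1) := by
  have hray : IsClosed ((Icc t 1).graphOn fun r : ℝ => u (z₀ + r • v)) := by
    convert ((isClosed_Icc (a := t) (b := 1)).preimage continuous_fst).inter (hgraph.preimage
      (f := fun q : ℝ × ℝ => (z₀ + q.1 • v, q.2)) (by fun_prop)) using 1
    ext q
    simp only [mem_graphOn, mem_inter_iff, mem_preimage]
    exact and_congr_right fun hq => (and_iff_right (hseg _ hq)).symm
  refine lipschitzOnWith_of_locally_lipschitz_off_null (S := {r ∈ Icc t 1 | z₀ + r • v ∉ U})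
    ordConnected_Icc isClosed_Icc hray (fun r hr hrS => ?_) fun ε hε => ?_
  · have hrU : z₀ + r • v ∈ U := by
      by_contra hrU
      exact hrS ⟨hr, hrU⟩
    have hcont : Continuous fun s : ℝ => z₀ + s • v := by fun_prop
    refine (((hcont.tendsto r).eventually (hloc _ hrU)).filter_mono
      nhdsWithin_le_nhds).frequently.mono fun s hs => hs.trans_eq ?_
    rw [dist_add_left, dist_eq_norm, ← sub_smul, norm_smul, coe_nnnorm, dist_eq_norm, mul_comm]
  · refine measure_mono_null ?_ (hnull ε hε)
    rintro _ ⟨r, ⟨hr, hrU⟩, rfl⟩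
    have hr0 : 0 < r := ht.trans_le hr.1
    refine ⟨(z₀ + r • v, u (z₀ + r • v)), ⟨⟨_, ⟨hseg r hr, hrU⟩, rfl⟩, r, hr0, rfl⟩, ?_⟩
    simp only [add_sub_cancel_left, norm_smul, Real.norm_of_nonneg hr0.le, coe_nnnorm]
    ring

theorem ae_dist_le_of_starConvex (hgraph : IsClosed (Ω.graphOn u)) (hΩ : StarConvex ℝ z₀ Ω)
    (hloc : ∀ ζ ∈ U, ∀ᶠ ξ in 𝓝 ζ, dist (u ξ) (u ζ) ≤ dist ξ ζ)
    (hdim : dimH ((Ω \ U).graphOn u) < 2) (hv : v ≠ 0) (ht : 0 < t) (ht1 : t ≤ 1) :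
    ∀ᵐ σ : ℝ, z₀ + (1 + σ * I) * v ∈ Ω →
      dist (u (z₀ + t • ((1 + σ * I) * v))) (u (z₀ + (1 + σ * I) * v)) ≤
        ‖(1 + σ * I) * v‖ * (1 - t) := by
  filter_upwards [ae_volume_image_ray_eq_zero hdim z₀ hv 1,
    ae_volume_image_ray_eq_zero hdim z₀ hv (-1)] with σ hpos hneg hσ
  have hLip : LipschitzOnWith ‖(1 + σ * I) * v‖₊ (fun r : ℝ => u (z₀ + r • ((1 + σ * I) * v)))
      (Icc t 1) := by
    refine lipschitzOnWith_ray hgraph hloc ht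
      (fun r hr => hΩ.add_smul_mem hσ (ht.le.trans hr.1) hr.2) fun ε hε => ?_
    rcases eq_or_eq_neg_of_abs_eq hε with rfl | rfl
    exacts [hpos, hneg]
  simpa [Real.dist_eq, abs_sub_comm t, abs_of_nonneg (sub_nonneg.2 ht1)] using
    hLip.dist_le_mul t (left_mem_Icc.2 ht1) 1 (right_mem_Icc.2 ht1)

theorem dist_le_of_starConvex (hgraph : IsClosed (Ω.graphOn u)) (hΩ : StarConvex ℝ z₀ Ω)
    (hU : IsOpen U) (hUΩ : U ⊆ Ω) (hloc : ∀ ζ ∈ U, ∀ᶠ ξ in 𝓝 ζ, dist (u ξ) (u ζ) ≤ dist ξ ζ)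
    (hdim : dimH ((Ω \ U).graphOn u) < 2) (ht : 0 < t) (ht1 : t ≤ 1) (hvU : z₀ + v ∈ U)
    (htU : z₀ + t • v ∈ U) :
    dist (u (z₀ + t • v)) (u (z₀ + v)) ≤ ‖v‖ * (1 - t) := by
  rcases eq_or_ne v 0 with rfl | hv
  · simp
  -- Almost every ray is good; perturb the given one and pass to the limit.
  set w : ℝ → ℂ := fun σ => (1 + σ * I) * v with hw
  have hwcont : Continuous w := by fun_prop
  have hw0 : w 0 = v := by simp [hw]
  set G : Set ℝ := {σ | z₀ + w σ ∈ Ω →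
    dist (u (z₀ + t • w σ)) (u (z₀ + w σ)) ≤ ‖w σ‖ * (1 - t)}
  have hG : Dense G := Measure.dense_of_ae (ae_dist_le_of_starConvex hgraph hΩ hloc hdim hv ht ht1)
  set V : Set ℝ := (fun σ => z₀ + w σ) ⁻¹' U
  have hV : IsOpen V := hU.preimage (by fun_prop)
  have h0 : (0 : ℝ) ∈ closure (V ∩ G) :=
    hG.open_subset_closure_inter hV (show z₀ + w 0 ∈ U by rwa [hw0])
  have hucont : ∀ ζ ∈ U, ContinuousAt u ζ := fun ζ hζ =>
    tendsto_iff_dist_tendsto_zero.2 (squeeze_zero' (Eventually.of_forall fun _ => dist_nonneg)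
      (hloc ζ hζ) (tendsto_iff_dist_tendsto_zero.1 tendsto_id))
  have hucomp {r : ℝ} (hr : z₀ + r • v ∈ U) : ContinuousAt (fun σ => u (z₀ + r • w σ)) 0 :=
    ContinuousAt.comp (f := fun σ => z₀ + r • w σ) (hucont _ (by rwa [hw0])) (by fun_prop)
  have hdist : ContinuousAt (fun σ => dist (u (z₀ + t • w σ)) (u (z₀ + w σ))) 0 := by
    simpa only [ContinuousAt, one_smul] using
      (hucomp htU).dist (hucomp (r := 1) (by rwa [one_smul]))
  have hle := ContinuousWithinAt.closure_le h0 hdist.continuousWithinAt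
    (hwcont.norm.mul_const (1 - t)).continuousAt.continuousWithinAt
    fun σ hσ => hσ.2 (hUΩ hσ.1)
  simpa only [hw0] using hle

end StarConvex

section SecondDerivative

variable {V : Type*} [NormedAddCommGroup V] [NormedSpace ℝ V]
  {F : Type*} [NormedAddCommGroup F] [NormedSpace ℝ F]

theorem differentiableAt_fderiv {f : V → F} {x : V} (hf : ContDiffAt ℝ 2 f x) :
    DifferentiableAt ℝ (fderiv ℝ f) x :=
  (hf.fderiv_right (m := 1) le_rfl).differentiableAt one_ne_zero

theorem fderiv_fderiv_apply {f : V → F} {x : V} (hf : ContDiffAt ℝ 2 f x) (v w : V) :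
    fderiv ℝ (fun y => fderiv ℝ f y v) x w = fderiv ℝ (fderiv ℝ f) x w v := by
  rw [fderiv_clm_apply (differentiableAt_fderiv hf) (differentiableAt_const v)]
  simp

theorem eventually_differentiableAt {f : V → F} {x : V} (hf : ContDiffAt ℝ 2 f x) :
    ∀ᶠ y in 𝓝 x, DifferentiableAt ℝ f y :=
  (hf.eventually (by simp)).mono fun _ hy => hy.differentiableAt two_ne_zero

theorem deriv_deriv_nonpos_of_isLocalMax {k : ℝ → ℝ} {a : ℝ} (hk : ContinuousAt k a)
    (hmax : IsLocalMax k a) : deriv (deriv k) a ≤ 0 := by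
  by_contra! hpos
  -- The second derivative test makes `a` a local minimum as well, so `k` is locally constant.
  have hmin : IsLocalMin k a := isLocalMin_of_deriv_deriv_pos hpos hmax.deriv_eq_zero hk
  have hconst : k =ᶠ[𝓝 a] fun _ => k a := by
    filter_upwards [hmin, hmax] with s h₁ h₂ using le_antisymm h₂ h₁
  have hderiv : deriv k =ᶠ[𝓝 a] fun _ => 0 := hconst.deriv.trans (by simp)
  simp [hderiv.deriv_eq] at hpos

theorem fderiv_fderiv_self_nonpos_of_isLocalMax {f : V → ℝ} {x : V} (hf : ContDiffAt ℝ 2 f x)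
    (hmax : IsLocalMax f x) (v : V) : fderiv ℝ (fderiv ℝ f) x v v ≤ 0 := by
  have hline (s : ℝ) : HasDerivAt (fun s : ℝ => x + s • v) v s := by
    simpa using ((hasDerivAt_id s).smul_const v).const_add x
  have htend : Tendsto (fun s : ℝ => x + s • v) (𝓝 0) (𝓝 x) := by
    simpa using (hline 0).continuousAt.tendsto
  have hderiv : deriv (fun s : ℝ => f (x + s • v)) =ᶠ[𝓝 0] fun s => fderiv ℝ f (x + s • v) v := by
    filter_upwards [htend.eventually (eventually_differentiableAt hf)] with s hs
    exact (hs.hasFDerivAt.comp_hasDerivAt s (hline s)).deriv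
  have hderiv₂ : deriv (fun s : ℝ => fderiv ℝ f (x + s • v) v) 0 =
      fderiv ℝ (fderiv ℝ f) x v v := by
    rw [← fderiv_fderiv_apply hf]
    exact (((differentiableAt_fderiv hf).clm_apply
      (differentiableAt_const v)).hasFDerivAt.comp_hasDerivAt_of_eq (0 : ℝ) (hline 0)
        (by simp)).deriv
  rw [← hderiv₂, ← hderiv.deriv_eq]
  refine deriv_deriv_nonpos_of_isLocalMax ?_ ?_
  · exact ContinuousAt.comp_of_eq hf.continuousAt (hline 0).continuousAt (by simp)
  · simpa [IsLocalMax, IsMaxFilter] using htend.eventually hmax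

theorem fderiv_fderiv_comp_self {f : V → ℝ} {φ : ℝ → ℝ} {x : V} (hφ : ContDiffAt ℝ 2 φ (f x))
    (hf : ContDiffAt ℝ 2 f x) (v : V) :
    fderiv ℝ (fderiv ℝ (φ ∘ f)) x v v =
      deriv (deriv φ) (f x) * fderiv ℝ f x v ^ 2 + deriv φ (f x) * fderiv ℝ (fderiv ℝ f) x v v := by
  have hfd : DifferentiableAt ℝ f x := hf.differentiableAt two_ne_zero
  have hderiv : DifferentiableAt ℝ (deriv φ) (f x) :=
    (differentiableAt_fderiv hφ).clm_apply (differentiableAt_const 1)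
  have hfderiv : fderiv ℝ (φ ∘ f) =ᶠ[𝓝 x] fun y => deriv φ (f y) • fderiv ℝ f y := by
    filter_upwards [eventually_differentiableAt hf,
      hf.continuousAt.eventually (eventually_differentiableAt hφ)] with y hy hφy
    exact (hφy.hasDerivAt.comp_hasFDerivAt y hy.hasFDerivAt).fderiv
  have hsmul : HasFDerivAt (fun y => deriv φ (f y) • fderiv ℝ f y) _ x :=
    (hderiv.hasDerivAt.comp_hasFDerivAt x hfd.hasFDerivAt).fun_smul
      (differentiableAt_fderiv hf).hasFDerivAt
  rw [hfderiv.fderiv_eq, hsmul.fderiv]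
  simp only [Function.comp_apply, add_apply, smul_apply,
    ContinuousLinearMap.smulRight_apply, smul_eq_mul]
  ring

end SecondDerivative

section Laplacian

variable {V : Type*} [NormedAddCommGroup V] [InnerProductSpace ℝ V] [FiniteDimensional ℝ V]
  {F : Type*} [NormedAddCommGroup F] [NormedSpace ℝ F] {ι : Type*} [Fintype ι]

theorem laplacian_eq_sum_fderiv_fderiv (f : V → F) (b : OrthonormalBasis ι ℝ V) (x : V) :
    Δ f x = ∑ i, fderiv ℝ (fderiv ℝ f) x (b i) (b i) := by
  simp [laplacian_eq_iteratedFDeriv_orthonormalBasis f b, iteratedFDeriv_two_apply]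

theorem laplacian_nonpos_of_isLocalMax {f : V → ℝ} {x : V} (hf : ContDiffAt ℝ 2 f x)
    (hmax : IsLocalMax f x) : Δ f x ≤ 0 := by
  rw [laplacian_eq_sum_fderiv_fderiv f (stdOrthonormalBasis ℝ V)]
  exact Finset.sum_nonpos fun i _ => fderiv_fderiv_self_nonpos_of_isLocalMax hf hmax _

theorem not_isLocalMax_sub_smul_of_laplacian_neg {h b : V → ℝ} {x : V} (hh : HarmonicAt h x)
    (hb : ContDiffAt ℝ 2 b x) (hΔ : Δ b x < 0) {ε : ℝ} (hε : 0 < ε) :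
    ¬ IsLocalMax (h - ε • b) x := by
  intro hmax
  have hεb : ContDiffAt ℝ 2 (ε • b) x := hb.const_smul ε
  have hle : Δ (h - ε • b) x ≤ 0 := laplacian_nonpos_of_isLocalMax (hh.1.sub hεb) hmax
  rw [hh.1.laplacian_sub hεb, laplacian_smul ε hb, hh.2.self_of_nhds] at hle
  have := mul_neg_of_pos_of_neg hε hΔ
  simp only [Pi.zero_apply, smul_eq_mul] at hle
  linarith

theorem laplacian_comp {f : V → ℝ} {φ : ℝ → ℝ} {x : V} (hφ : ContDiffAt ℝ 2 φ (f x))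
    (hf : ContDiffAt ℝ 2 f x) (b : OrthonormalBasis ι ℝ V) :
    Δ (φ ∘ f) x =
      deriv (deriv φ) (f x) * ∑ i, fderiv ℝ f x (b i) ^ 2 + deriv φ (f x) * Δ f x := by
  simp only [laplacian_eq_sum_fderiv_fderiv _ b, fderiv_fderiv_comp_self hφ hf,
    Finset.sum_add_distrib, Finset.mul_sum]

end Laplacian

section Lorentz

theorem lorentz_comm (x y : E3) : lorentz x y = lorentz y x := by
  simp only [lorentz]; ring

theorem lorentz_add_left (x y w : E3) : lorentz (x + y) w = lorentz x w + lorentz y w := by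
  simp only [lorentz, PiLp.add_apply]; ring

theorem lorentz_smul_left (c : ℝ) (x w : E3) : lorentz (c • x) w = c * lorentz x w := by
  simp only [lorentz, PiLp.smul_apply, smul_eq_mul]; ring

theorem lorentz_smul_right (c : ℝ) (x w : E3) : lorentz x (c • w) = c * lorentz x w := by
  simp only [lorentz, PiLp.smul_apply, smul_eq_mul]; ring

/-- The Lorentzian cross product, a normal vector to the plane spanned by `a` and `b`. -/
noncomputable def lorentzCross (a b : E3) : E3 :=
  !₂[a 1 * b 2 - a 2 * b 1, a 2 * b 0 - a 0 * b 2, -(a 0 * b 1 - a 1 * b 0)]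

theorem lorentz_left_lorentzCross (a b : E3) : lorentz a (lorentzCross a b) = 0 := by
  simp only [lorentz, lorentzCross, Matrix.cons_val_zero, Matrix.cons_val_one, Matrix.cons_val]
  ring

theorem lorentz_right_lorentzCross (a b : E3) : lorentz b (lorentzCross a b) = 0 := by
  simp only [lorentz, lorentzCross, Matrix.cons_val_zero, Matrix.cons_val_one, Matrix.cons_val]
  ring

theorem lorentz_lorentzCross_self (a b : E3) :
    lorentz (lorentzCross a b) (lorentzCross a b) =
      -(lorentz a a * lorentz b b - lorentz a b ^ 2) := by
  simp only [lorentz, lorentzCross, Matrix.cons_val_zero, Matrix.cons_val_one, Matrix.cons_val]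
  ring

theorem gram_smul_eq (a b w : E3) :
    (lorentz a a * lorentz b b - lorentz a b ^ 2) • w =
      (lorentz b b * lorentz w a - lorentz a b * lorentz w b) • a +
      (lorentz a a * lorentz w b - lorentz a b * lorentz w a) • b -
      lorentz w (lorentzCross a b) • lorentzCross a b := by
  ext i
  fin_cases i <;>
    simp only [lorentz, lorentzCross, Fin.zero_eta, Fin.mk_one, Fin.reduceFinMk, PiLp.add_apply,
      PiLp.sub_apply, PiLp.smul_apply, smul_eq_mul, Matrix.cons_val_zero, Matrix.cons_val_one,
      Matrix.cons_val] <;>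
    ring

theorem mul_lorentz_self_le {a b w : E3} (hE : lorentz a a = lorentz b b) (hF : lorentz a b = 0)
    (hpos : 0 < lorentz a a) :
    lorentz a a * lorentz w w ≤ lorentz a w ^ 2 + lorentz b w ^ 2 := by
  have hgram := congrArg (lorentz · w) (gram_smul_eq a b w)
  simp only [sub_eq_add_neg, ← neg_smul, lorentz_add_left, lorentz_smul_left, ← hE, hF,
    lorentz_comm w] at hgram
  refine le_of_mul_le_mul_left ?_ hpos
  nlinarith [sq_nonneg (lorentz (lorentzCross a b) w)]

theorem contDiff_lorentz {n : WithTop ℕ∞} : ContDiff ℝ n fun p : E3 × E3 => lorentz p.1 p.2 := by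
  unfold lorentz; fun_prop

theorem fderiv_lorentz_apply {V : Type*} [NormedAddCommGroup V] [NormedSpace ℝ V] {f g : V → E3}
    {x : V} (hf : DifferentiableAt ℝ f x) (hg : DifferentiableAt ℝ g x) (v : V) :
    fderiv ℝ (fun y => lorentz (f y) (g y)) x v =
      lorentz (fderiv ℝ f x v) (g x) + lorentz (f x) (fderiv ℝ g x v) := by
  have hcoord {k : V → E3} (hk : DifferentiableAt ℝ k x) (i : Fin 3) :
      HasFDerivAt (fun y => k y i) ((EuclideanSpace.proj i).comp (fderiv ℝ k x)) x :=
    (EuclideanSpace.proj (𝕜 := ℝ) i).hasFDerivAt.comp x hk.hasFDerivAt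
  have hprod (i : Fin 3) := (hcoord hf i).fun_mul (hcoord hg i)
  simp only [lorentz]
  rw [(((hprod 0).fun_add (hprod 1)).fun_sub (hprod 2)).fderiv]
  simp only [sub_apply, add_apply, smul_apply, ContinuousLinearMap.comp_apply, PiLp.proj_apply,
    smul_eq_mul]
  ring

theorem fderiv_fderiv_lorentz_self {V : Type*} [NormedAddCommGroup V] [NormedSpace ℝ V]
    {f : V → E3} {x : V} (hf : ContDiffAt ℝ 2 f x) (v : V) :
    fderiv ℝ (fderiv ℝ fun y => lorentz (f y) (f y)) x v v =
      2 * (lorentz (fderiv ℝ (fderiv ℝ f) x v v) (f x) +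
        lorentz (fderiv ℝ f x v) (fderiv ℝ f x v)) := by
  have hfd : DifferentiableAt ℝ f x := hf.differentiableAt two_ne_zero
  have hDf : DifferentiableAt ℝ (fun y => fderiv ℝ f y v) x :=
    (differentiableAt_fderiv hf).clm_apply (differentiableAt_const v)
  have hderiv : (fun y => fderiv ℝ (fun y => lorentz (f y) (f y)) y v) =ᶠ[𝓝 x]
      fun y => lorentz (fderiv ℝ f y v) (f y) + lorentz (f y) (fderiv ℝ f y v) :=
    (eventually_differentiableAt hf).mono fun y hy => fderiv_lorentz_apply hy hy v
  have hlor {g k : V → E3} (hg : DifferentiableAt ℝ g x) (hk : DifferentiableAt ℝ k x) :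
      DifferentiableAt ℝ (fun y => lorentz (g y) (k y)) x :=
    (contDiff_lorentz (n := 1).differentiable one_ne_zero).differentiableAt.comp x (hg.prodMk hk)
  have hC2 : ContDiffAt ℝ 2 (fun y => lorentz (f y) (f y)) x :=
    contDiff_lorentz.contDiffAt.comp x (hf.prodMk hf)
  rw [← fderiv_fderiv_apply hC2,
    hderiv.fderiv_eq, fderiv_fun_add (hlor hDf hfd) (hlor hfd hDf), add_apply,
    fderiv_lorentz_apply hDf hfd, fderiv_lorentz_apply hfd hDf, fderiv_fderiv_apply hf,
    lorentz_comm (f x)]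
  ring

end Lorentz

section Parametrized

variable {Y : ℂ → E3} {z : ℂ}

theorem D_eq_re_smul_add_im_smul (Y : ℂ → E3) (a z : ℂ) :
    D Y a z = a.re • D Y 1 z + a.im • D Y I z := by
  have ha : a = a.re • (1 : ℂ) + a.im • I := by simp [re_add_im]
  conv_lhs => rw [ha]
  simp only [D, map_add, map_smul]

theorem differentiableAt_D (hY : ContDiffAt ℝ 2 Y z) (a : ℂ) : DifferentiableAt ℝ (D Y a) z :=
  (differentiableAt_fderiv hY).clm_apply (differentiableAt_const a)

theorem D_D_comm (hY : ContDiffAt ℝ 2 Y z) (a b : ℂ) : D (D Y a) b z = D (D Y b) a z := by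
  have hD (a b : ℂ) : D (D Y a) b z = fderiv ℝ (fderiv ℝ Y) z b a := fderiv_fderiv_apply hY a b
  rw [hD, hD]
  exact hY.isSymmSndFDerivAt (by simp) b a

theorem laplacian_eq_D_D_add (hY : ContDiffAt ℝ 2 Y z) :
    Δ Y z = D (D Y 1) 1 z + D (D Y I) I z := by
  have hD (a b : ℂ) : D (D Y a) b z = fderiv ℝ (fderiv ℝ Y) z b a := fderiv_fderiv_apply hY a b
  simp [laplacian_eq_sum_fderiv_fderiv Y orthonormalBasisOneI, hD]

theorem fderiv_firstForm (hY : ContDiffAt ℝ 2 Y z) (a b c : ℂ) :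
    fderiv ℝ (fun w => firstForm Y w a b) z c =
      lorentz (D (D Y a) c z) (D Y b z) + lorentz (D (D Y b) c z) (D Y a z) := by
  rw [lorentz_comm (D (D Y b) c z)]
  exact fderiv_lorentz_apply (differentiableAt_D hY a) (differentiableAt_D hY b) c

theorem lorentz_laplacian_D_eq_zero (hY : ContDiffAt ℝ 2 Y z)
    (hiso : ∀ᶠ w in 𝓝 z, IsothermalAt Y w) (a : ℂ) : lorentz (Δ Y z) (D Y a z) = 0 := by
  have hE : (fun w => firstForm Y w 1 1) =ᶠ[𝓝 z] fun w => firstForm Y w I I :=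
    hiso.mono fun _ hw => hw.1
  have hF : (fun w => firstForm Y w 1 I) =ᶠ[𝓝 z] fun _ => 0 := hiso.mono fun _ hw => hw.2
  have hdE (c : ℂ) : lorentz (D (D Y 1) c z) (D Y 1 z) = lorentz (D (D Y I) c z) (D Y I z) := by
    have := DFunLike.congr_fun (hE.fderiv_eq (𝕜 := ℝ)) c
    rw [fderiv_firstForm hY, fderiv_firstForm hY] at this
    linarith
  have hdF (c : ℂ) :
      lorentz (D (D Y 1) c z) (D Y I z) + lorentz (D (D Y I) c z) (D Y 1 z) = 0 := by
    simpa [fderiv_firstForm hY] using DFunLike.congr_fun (hF.fderiv_eq (𝕜 := ℝ)) c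
  have hcomm := D_D_comm hY 1 I
  have h₁ : lorentz (Δ Y z) (D Y 1 z) = 0 := by
    rw [laplacian_eq_D_D_add hY, lorentz_add_left, hdE, ← hcomm]
    exact hdF I
  have hI : lorentz (Δ Y z) (D Y I z) = 0 := by
    rw [laplacian_eq_D_D_add hY, lorentz_add_left, ← hdE, hcomm]
    exact hdF 1
  rw [D_eq_re_smul_add_im_smul, lorentz_comm, lorentz_add_left, lorentz_smul_left,
    lorentz_smul_left, lorentz_comm, h₁, lorentz_comm, hI, mul_zero, mul_zero, add_zero]

theorem isUnitNormal_inv_smul_lorentzCross (hiso : IsothermalAt Y z) (hE : firstForm Y z 1 1 ≠ 0) :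
    IsUnitNormal Y z ((firstForm Y z 1 1)⁻¹ • lorentzCross (D Y 1 z) (D Y I z)) := by
  obtain ⟨hEG, hF⟩ := hiso
  simp only [firstForm] at *
  refine ⟨?_, fun a => ?_⟩
  · rw [lorentz_smul_left, lorentz_smul_right, lorentz_lorentzCross_self, ← hEG, hF]
    field_simp
    simp
  · rw [D_eq_re_smul_add_im_smul, lorentz_smul_right, lorentz_add_left, lorentz_smul_left,
      lorentz_smul_left, lorentz_left_lorentzCross, lorentz_right_lorentzCross]
    simp

theorem meanCurvature_eq_of_isothermalAt (hY : ContDiffAt ℝ 2 Y z) (hiso : IsothermalAt Y z)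
    (hE : firstForm Y z 1 1 ≠ 0) (N : E3) :
    meanCurvature Y N z = lorentz (Δ Y z) N / (2 * firstForm Y z 1 1) := by
  rw [meanCurvature, ← hiso.1, hiso.2, laplacian_eq_D_D_add hY, lorentz_add_left]
  simp only [secondForm]
  field_simp
  ring

theorem laplacian_eq_zero_of_meanCurvature_eq_zero (hY : ContDiffAt ℝ 2 Y z)
    (hiso : ∀ᶠ w in 𝓝 z, IsothermalAt Y w) (hsp : SpacelikeAt Y z)
    (hmean : ∀ N, IsUnitNormal Y z N → meanCurvature Y N z = 0) : Δ Y z = 0 := by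
  have hE : firstForm Y z 1 1 ≠ 0 := (hsp 1 one_ne_zero).ne'
  obtain ⟨hEG, hF⟩ := hiso.self_of_nhds
  have hnormal : lorentz (Δ Y z) (lorentzCross (D Y 1 z) (D Y I z)) = 0 := by
    have := hmean _ (isUnitNormal_inv_smul_lorentzCross hiso.self_of_nhds hE)
    rw [meanCurvature_eq_of_isothermalAt hY hiso.self_of_nhds hE, lorentz_smul_right] at this
    simpa [hE] using this
  have hgram := gram_smul_eq (D Y 1 z) (D Y I z) (Δ Y z)
  rw [lorentz_laplacian_D_eq_zero hY hiso, lorentz_laplacian_D_eq_zero hY hiso, hnormal] at hgram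
  simp only [firstForm] at hE hEG hF
  simpa [← hEG, hF, hE] using hgram

theorem laplacian_comp_lorentz_self_neg (hY : ContDiffAt ℝ 2 Y z) (hiso : IsothermalAt Y z)
    (hsp : SpacelikeAt Y z) (hΔ : Δ Y z = 0) {φ : ℝ → ℝ}
    (hφ : ContDiffAt ℝ 2 φ (lorentz (Y z) (Y z)))
    (hconcave : deriv (deriv φ) (lorentz (Y z) (Y z)) ≤ 0)
    (hlog : deriv φ (lorentz (Y z) (Y z)) +
      lorentz (Y z) (Y z) * deriv (deriv φ) (lorentz (Y z) (Y z)) < 0) :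
    Δ (φ ∘ fun w => lorentz (Y w) (Y w)) z < 0 := by
  have hYd : DifferentiableAt ℝ Y z := hY.differentiableAt two_ne_zero
  have hψ : ContDiffAt ℝ 2 (fun w => lorentz (Y w) (Y w)) z :=
    contDiff_lorentz.contDiffAt.comp z (hY.prodMk hY)
  have hE : 0 < firstForm Y z 1 1 := hsp 1 one_ne_zero
  have hψΔ : Δ (fun w => lorentz (Y w) (Y w)) z = 4 * firstForm Y z 1 1 := by
    have hΔY : lorentz (Δ Y z) (Y z) = 0 := by simp [hΔ, lorentz]
    have hEG : lorentz (fderiv ℝ Y z 1) (fderiv ℝ Y z 1) =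
        lorentz (fderiv ℝ Y z I) (fderiv ℝ Y z I) := hiso.1
    simp only [laplacian_eq_sum_fderiv_fderiv _ orthonormalBasisOneI, Fin.sum_univ_two,
      coe_orthonormalBasisOneI, Matrix.cons_val_zero, Matrix.cons_val_one, lorentz_add_left,
      fderiv_fderiv_lorentz_self hY] at hΔY ⊢
    simp only [firstForm, D]
    linarith
  have hgrad (a : ℂ) :
      fderiv ℝ (fun w => lorentz (Y w) (Y w)) z a = 2 * lorentz (D Y a z) (Y z) := by
    rw [fderiv_lorentz_apply hYd hYd, lorentz_comm (Y z), D]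
    ring
  rw [laplacian_comp (f := fun w => lorentz (Y w) (Y w)) hφ hψ orthonormalBasisOneI, hψΔ]
  simp only [Fin.sum_univ_two, coe_orthonormalBasisOneI, Matrix.cons_val_zero,
    Matrix.cons_val_one, hgrad]
  have hquad := mul_le_mul_of_nonpos_left
    (mul_lorentz_self_le (w := Y z) hiso.1 hiso.2 hE) hconcave
  have hneg := mul_neg_of_pos_of_neg hE hlog
  simp only [firstForm] at *
  nlinarith

end Parametrized

section FirstOrder

variable {V : Type*} [NormedAddCommGroup V] [NormedSpace ℝ V] [FiniteDimensional ℝ V]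
  {F G : Type*} [NormedAddCommGroup F] [NormedSpace ℝ F] [NormedAddCommGroup G] [NormedSpace ℝ G]

theorem exists_pos_forall_norm_add_le {f : V →L[ℝ] F} {g : V →L[ℝ] G}
    (hlt : ∀ v ≠ 0, ‖g v‖ < ‖f v‖) : ∃ c > 0, ∀ v, ‖g v‖ + c * ‖v‖ ≤ ‖f v‖ := by
  have hcont : ContinuousOn (fun v => ‖f v‖ - ‖g v‖) (Metric.sphere 0 1) := by fun_prop
  obtain ⟨c, hc, hle⟩ := (isCompact_sphere (0 : V) 1).exists_forall_le' hcont (a := 0)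
    fun v hv => sub_pos.2 (hlt v (ne_zero_of_mem_unit_sphere ⟨v, hv⟩))
  refine ⟨c, hc, fun v => ?_⟩
  rcases eq_or_ne v 0 with rfl | hv
  · simp
  have hv' : 0 < ‖v‖ := norm_pos_iff.2 hv
  have hunit := hle (‖v‖⁻¹ • v) (by simp [norm_smul, hv'.ne'])
  simp only [map_smul, norm_smul, norm_inv, norm_norm, inv_mul_eq_div, ← sub_div] at hunit
  rw [le_div_iff₀ hv'] at hunit
  linarith

theorem exists_lt_one_eventually_norm_sub_le {f : V → F} {g : V → G} {f' : V →L[ℝ] F}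
    {g' : V →L[ℝ] G} {x : V} (hf : HasFDerivAt f f' x) (hg : HasFDerivAt g g' x)
    (hlt : ∀ v ≠ 0, ‖g' v‖ < ‖f' v‖) :
    ∃ κ < (1 : ℝ), ∀ᶠ y in 𝓝 x, ‖g y - g x‖ ≤ κ * ‖f y - f x‖ := by
  obtain ⟨c, hc, hle⟩ := exists_pos_forall_norm_add_le hlt
  set C := ‖f'‖ + c / 4
  have hC : 0 < C := by positivity
  refine ⟨1 - c / 2 / C, sub_lt_self 1 (by positivity), ?_⟩
  filter_upwards [hf.isLittleO.def (show 0 < c / 4 by positivity),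
    hg.isLittleO.def (show 0 < c / 4 by positivity)] with y hfy hgy
  have hgle : ‖g y - g x‖ ≤ ‖g' (y - x)‖ + c / 4 * ‖y - x‖ :=
    (norm_le_norm_add_norm_sub' _ _).trans (by gcongr)
  have hf'le : ‖f' (y - x)‖ ≤ ‖f y - f x‖ + c / 4 * ‖y - x‖ :=
    (norm_le_norm_add_norm_sub _ _).trans (by gcongr)
  have hfle : ‖f y - f x‖ ≤ C * ‖y - x‖ := by
    refine (norm_le_norm_add_norm_sub' _ (f' (y - x))).trans ?_
    rw [add_mul]
    gcongr
    exact f'.le_opNorm _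
  have hslack : c / 2 / C * ‖f y - f x‖ ≤ c / 2 * ‖y - x‖ := by
    rw [div_mul_eq_mul_div, div_le_iff₀ hC, mul_assoc, mul_comm ‖y - x‖]
    gcongr
  linarith [hle (y - x)]

end FirstOrder

section Coordinates

/-- The splitting `x ↦ (π₀(x), x₃)` of `ℝ³₁` into its spacelike plane and its timelike axis. -/
noncomputable def prodEquiv : E3 ≃L[ℝ] ℂ × ℝ :=
  LinearEquiv.toContinuousLinearEquiv
    { toFun := fun x => (proj₀ x, x 2)
      invFun := fun p => !₂[p.1.re, p.1.im, p.2]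
      map_add' := fun x y => by simp [proj₀, Complex.ext_iff]
      map_smul' := fun c x => by simp [proj₀, Complex.ext_iff]
      left_inv := fun x => by ext i; fin_cases i <;> simp [proj₀]
      right_inv := fun p => by simp [proj₀] }

theorem prodEquiv_apply (x : E3) : prodEquiv x = (proj₀ x, x 2) := rfl

theorem continuous_proj₀ : Continuous proj₀ := prodEquiv.continuous.fst

theorem proj₀_sub (x y : E3) : proj₀ (x - y) = proj₀ x - proj₀ y :=
  congrArg Prod.fst (map_sub prodEquiv x y)

theorem lorentz_self (x : E3) : lorentz x x = ‖proj₀ x‖ ^ 2 - x 2 ^ 2 := by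
  rw [← normSq_eq_norm_sq, normSq_apply, lorentz, proj₀]
  ring

theorem IsGraphOver.exists_image_prodEquiv_eq {S : Set E3} {Ω : Set ℂ} (h : IsGraphOver S Ω) :
    ∃ u : ℂ → ℝ, prodEquiv '' S = Ω.graphOn u := by
  obtain ⟨u, rfl⟩ := h
  refine ⟨u, ?_⟩
  ext p
  obtain ⟨x, rfl⟩ := prodEquiv.surjective p
  rw [prodEquiv.injective.mem_set_image, mem_graphOn, prodEquiv_apply]
  simp [eq_comm]

variable {Y : ℂ → E3} {z : ℂ}

theorem SpacelikeAt.abs_lt (hsp : SpacelikeAt Y z) {a : ℂ} (ha : a ≠ 0) :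
    |D Y a z 2| < ‖proj₀ (D Y a z)‖ := by
  have hpos := hsp a ha
  rw [firstForm, lorentz_self, sub_pos] at hpos
  exact abs_lt_of_sq_lt_sq hpos (norm_nonneg _)

theorem SpacelikeAt.map_nhds_proj₀_comp (hsp : SpacelikeAt Y z) (hY : ContDiffAt ℝ 1 Y z) :
    map (proj₀ ∘ Y) (𝓝 z) = 𝓝 (proj₀ (Y z)) := by
  have hderiv : HasStrictFDerivAt (proj₀ ∘ Y) _ z :=
    (prodEquiv.hasStrictFDerivAt.comp z (hY.hasStrictFDerivAt one_ne_zero)).fst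
  refine hderiv.map_nhds_eq_of_surj ?_
  refine LinearMap.range_eq_top.2 (LinearMap.injective_iff_surjective.1 ?_)
  refine (injective_iff_map_eq_zero _).2 fun a ha => ?_
  by_contra hne
  have hzero : proj₀ (D Y a z) = 0 := ha
  have hlt := hsp.abs_lt hne
  rw [hzero, norm_zero] at hlt
  exact hlt.not_ge (abs_nonneg _)

theorem SpacelikeAt.exists_lt_one_eventually_abs_sub_le (hsp : SpacelikeAt Y z)
    (hY : DifferentiableAt ℝ Y z) :
    ∃ κ < (1 : ℝ), ∀ᶠ w in 𝓝 z, |Y w 2 - Y z 2| ≤ κ * ‖proj₀ (Y w) - proj₀ (Y z)‖ := by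
  have hderiv := prodEquiv.hasFDerivAt.comp z hY.hasFDerivAt
  exact exists_lt_one_eventually_norm_sub_le hderiv.fst hderiv.snd fun a ha => hsp.abs_lt ha

end Coordinates

theorem isCompact_inter_preimage {α β : Type*} [TopologicalSpace α] [TopologicalSpace β]
    {s : Set α} {f : α → β} (hf : IsProperMap (s.domRestrict f)) {K : Set β} (hK : IsCompact K) :
    IsCompact (s ∩ f ⁻¹' K) := by
  rw [← Subtype.image_preimage_coe]
  exact (hf.isCompact_preimage hK).image continuous_subtype_val

section Boundary

variable {R : Type*} [TopologicalSpace R] [ChartedSpace ℂ R]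

theorem PiecewiseC1.continuous {c : ℝ → R} (hc : PiecewiseC1 c) : Continuous c := by
  refine continuous_iff_continuousAt.2 fun t => ?_
  obtain ⟨ε, hε, hleft, hright⟩ := hc t
  refine continuousAt_iff_continuous_left_right.2 ⟨?_, ?_⟩
  · exact (hleft.continuousOn t (right_mem_Icc.2 (by linarith))).mono_of_mem_nhdsWithin
      (Icc_mem_nhdsLE (by linarith))
  · exact (hright.continuousOn t (left_mem_Icc.2 (by linarith))).mono_of_mem_nhdsWithin
      (Icc_mem_nhdsGE (by linarith))

theorem PiecewiseC1.dimH_image_range_le {F : Type*} [NormedAddCommGroup F] [NormedSpace ℝ F]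
    {c : ℝ → R} (hc : PiecewiseC1 c) {X : R → F} (hX : ContMDiff 𝓘(ℝ, ℂ) 𝓘(ℝ, F) 1 X) :
    dimH (X '' range c) ≤ 1 := by
  have hIcc {a b : ℝ} (hab : ContMDiffOn 𝓘(ℝ, ℝ) 𝓘(ℝ, ℂ) 1 c (Icc a b)) :
      dimH ((X ∘ c) '' Icc a b) ≤ 1 := by
    have hXc : ContDiffOn ℝ 1 (X ∘ c) (Icc a b) :=
      contMDiffOn_iff_contDiffOn.1 (hX.comp_contMDiffOn hab)
    calc dimH ((X ∘ c) '' Icc a b) ≤ dimH (Icc a b) := hXc.dimH_image_le (convex_Icc a b) le_rfl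
      _ ≤ dimH (univ : Set ℝ) := dimH_mono (subset_univ _)
      _ = 1 := Real.dimH_univ
  choose ε hε hleft hright using hc
  obtain ⟨s, hs, hcover⟩ := TopologicalSpace.countable_cover_nhds
    (f := fun t => Icc (t - ε t) (t + ε t)) fun t =>
      Icc_mem_nhds (sub_lt_self t (hε t)) (lt_add_of_pos_right t (hε t))
  rw [← range_comp, ← image_univ, ← hcover, image_iUnion₂, dimH_bUnion hs]
  refine iSup₂_le fun t _ => ?_
  rw [← Icc_union_Icc_eq_Icc (sub_le_self t (hε t).le) (le_add_of_nonneg_right (hε t).le),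
    image_union, dimH_union]
  exact max_le (hIcc (hleft t)) (hIcc (hright t))

theorem IsSimpleLoop.isCompact {Γ : Set R} (hΓ : IsSimpleLoop Γ) : IsCompact Γ := by
  obtain ⟨c, hc, hper, -, rfl⟩ := hΓ
  rw [← hper.image_Icc zero_lt_one 0]
  exact isCompact_Icc.image hc.continuous

namespace BorderedSurface

variable {M : BorderedSurface R}

theorem isClosed_boundary [T2Space R] : IsClosed M.boundary := by
  obtain ⟨𝒞, -, hfin, hunion, h𝒞⟩ := M.boundary_curves
  rw [← hunion, sUnion_eq_iUnion]
  refine hfin.isClosed_iUnion fun Γ => ?_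
  rcases h𝒞 Γ Γ.2 with ⟨p, hp⟩ | ⟨hloop | ⟨c, -, hc, hrange⟩, -⟩
  · exact hp ▸ isClosed_singleton
  · exact hloop.isCompact.isClosed
  · exact hrange ▸ hc.isClosed_range

theorem isOpen_int [T2Space R] : IsOpen M.int := by
  have hint : M.int = interior M.carrier \ M.boundary := by
    refine Subset.antisymm (fun p hp => ⟨?_, hp.2⟩) (sdiff_subset_sdiff_left interior_subset)
    by_contra hfrontier
    exact hp.2 (M.frontier_subset ⟨subset_closure hp.1, hfrontier⟩)
  exact hint ▸ isOpen_interior.sdiff isClosed_boundary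

theorem dimH_image_boundary_le {F : Type*} [NormedAddCommGroup F] [NormedSpace ℝ F] [ProperSpace F]
    {X : R → F} (hX : ContMDiff 𝓘(ℝ, ℂ) 𝓘(ℝ, F) 1 X)
    (hproper : IsProperMap (M.carrier.domRestrict X)) : dimH (X '' M.boundary) ≤ 1 := by
  obtain ⟨𝒞, -, hfin, hunion, h𝒞⟩ := M.boundary_curves
  have hne (Γ) (hΓ : Γ ∈ 𝒞) : Γ.Nonempty := by
    rcases h𝒞 Γ hΓ with ⟨p, rfl⟩ | ⟨⟨c, -, -, -, rfl⟩ | ⟨c, -, -, rfl⟩, -⟩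
    exacts [singleton_nonempty p, range_nonempty c, range_nonempty c]
  have hcount : Countable 𝒞 := by
    refine countable_univ_iff.1 <| (countable_iUnion fun n : ℕ =>
      (hfin.finite_nonempty_inter_compact
        (isCompact_inter_preimage hproper (isCompact_closedBall 0 (n : ℝ)))).countable).mono ?_
    intro Γ _
    obtain ⟨p, hp⟩ := hne Γ Γ.2
    obtain ⟨n, hn⟩ := exists_nat_ge ‖X p‖
    exact mem_iUnion.2 ⟨n, p, hp, M.boundary_subset (hunion ▸ mem_sUnion_of_mem hp Γ.2),
      by simpa using hn⟩
  rw [← hunion, sUnion_eq_iUnion, image_iUnion, dimH_iUnion]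
  refine iSup_le fun Γ => ?_
  rcases h𝒞 Γ Γ.2 with ⟨p, hp⟩ | ⟨⟨c, hc, -, -, hrange⟩ | ⟨c, hc, -, hrange⟩, -⟩
  · simp [hp]
  · exact hrange ▸ hc.dimH_image_range_le hX
  · exact hrange ▸ hc.dimH_image_range_le hX

end BorderedSurface

end Boundary

section Harmonic

theorem eventually_eq_of_isLocalMax_of_harmonicAt {h : ℂ → ℝ} {z : ℂ}
    (hh : ∀ᶠ w in 𝓝 z, HarmonicAt h w) (hmax : IsLocalMax h z) : ∀ᶠ w in 𝓝 z, h w = h z := by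
  obtain ⟨r, hr, hball⟩ := Metric.eventually_nhds_iff_ball.1 hh
  obtain ⟨F, hF, hre⟩ := HarmonicOnNhd.exists_analyticOnNhd_ball_re_eq (f := h) hball
  have hnorm : ∀ w ∈ Metric.ball z r, ‖exp (F w)‖ = Real.exp (h w) := fun w hw =>
    (norm_exp (F w)).trans (congrArg Real.exp (hre hw))
  have hz := Metric.mem_ball_self (x := z) hr
  have hnear := Metric.ball_mem_nhds z hr
  have hmax' : IsLocalMax (norm ∘ fun w => exp (F w)) z := by
    filter_upwards [hmax, hnear] with w hw hwr
    simpa [hnorm w hwr, hnorm z hz] using hw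
  have hdiff : ∀ᶠ w in 𝓝 z, DifferentiableAt ℂ (fun w => exp (F w)) w := by
    filter_upwards [hnear] with w hw using (hF w hw).differentiableAt.cexp
  filter_upwards [norm_eventually_eq_of_isLocalMax hdiff hmax', hnear] with w hw hwr
  exact Real.exp_injective (by rwa [hnorm w hwr, hnorm z hz] at hw)

variable {R : Type*} [TopologicalSpace R] [ChartedSpace ℂ R]

theorem isLocalMax_comp_chartAt_symm {f : R → ℝ} {p : R} (hmax : IsLocalMax f p) :
    IsLocalMax (f ∘ (chartAt ℂ p).symm) (chartAt ℂ p p) := by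
  have hp := mem_chart_source ℂ p
  refine IsMaxFilter.comp_tendsto ?_ ((chartAt ℂ p).tendsto_symm hp)
  rwa [(chartAt ℂ p).left_inv hp]

theorem eventually_chartAt_symm_mem {U : Set R} (hU : IsOpen U) {p : R} (hp : p ∈ U) :
    ∀ᶠ w in 𝓝 (chartAt ℂ p p), w ∈ (chartAt ℂ p).target ∧ (chartAt ℂ p).symm w ∈ U :=
  ((chartAt ℂ p).open_target.eventually_mem (mem_chart_target ℂ p)).and
    (((chartAt ℂ p).tendsto_symm (mem_chart_source ℂ p)).eventually (hU.eventually_mem hp))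

theorem HarmonicOnSurface.neg {f : R → ℝ} {U : Set R} (hf : HarmonicOnSurface f U) :
    HarmonicOnSurface (-f) U := fun e he z hz => (hf e he z hz).neg

theorem HarmonicOnSurface.eventually_eq_of_isLocalMax {f : R → ℝ} {U : Set R}
    (hf : HarmonicOnSurface f U) (hU : IsOpen U) {p : R} (hp : p ∈ U) (hmax : IsLocalMax f p) :
    ∀ᶠ q in 𝓝 p, f q = f p := by
  have hps := mem_chart_source ℂ p
  have hharm : ∀ᶠ w in 𝓝 (chartAt ℂ p p), HarmonicAt (f ∘ (chartAt ℂ p).symm) w :=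
    (eventually_chartAt_symm_mem hU hp).mono (hf _ (chart_mem_atlas ℂ p))
  have hconst := eventually_eq_of_isLocalMax_of_harmonicAt hharm (isLocalMax_comp_chartAt_symm hmax)
  rw [← (chartAt ℂ p).symm_map_nhds_eq hps, eventually_map]
  simpa [(chartAt ℂ p).left_inv hps] using hconst

end Harmonic

section Immersion

theorem D_sub_const (Y : ℂ → E3) (x₀ : E3) : D (fun w => Y w - x₀) = D Y := by
  ext a z : 2
  rw [D, fderiv_sub_const, D]

variable {R : Type*} [TopologicalSpace R] [ChartedSpace ℂ R] {M : BorderedSurface R} {X : R → E3}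

namespace IsConformalMaximalImmersion

theorem sub_const (hX : IsConformalMaximalImmersion M X) (x₀ : E3) :
    IsConformalMaximalImmersion M fun p => X p - x₀ where
  smooth := hX.smooth.sub contMDiff_const
  spacelike e he z hz hze := by
    simpa only [SpacelikeAt, firstForm, D_sub_const, Function.comp_def] using
      hX.spacelike e he z hz hze
  conformal e he z hz hze := by
    simpa only [IsothermalAt, firstForm, D_sub_const, Function.comp_def] using
      hX.conformal e he z hz hze
  maximal e he z hz hze := by
    simpa only [IsUnitNormal, meanCurvature, firstForm, secondForm, D_sub_const,
      Function.comp_def] using hX.maximal e he z hz hze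

theorem contDiffAt_comp_chartAt_symm (hX : IsConformalMaximalImmersion M X) (p : R) :
    ContDiffAt ℝ 2 (X ∘ (chartAt ℂ p).symm) (chartAt ℂ p p) := by
  have hXp := (contMDiffAt_iff.1 (hX.smooth p)).2
  simp only [mfld_simps, contDiffWithinAt_univ] at hXp
  exact hXp.of_le ENat.LEInfty.out

variable {p : R}

theorem spacelikeAt_comp_chartAt_symm (hX : IsConformalMaximalImmersion M X) (hp : p ∈ M.int) :
    SpacelikeAt (X ∘ (chartAt ℂ p).symm) (chartAt ℂ p p) :=
  hX.spacelike _ (chart_mem_atlas ℂ p) _ (mem_chart_target ℂ p)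
    (by rwa [(chartAt ℂ p).left_inv (mem_chart_source ℂ p)])

theorem map_nhds_proj₀_comp (hX : IsConformalMaximalImmersion M X) (hp : p ∈ M.int) :
    map (proj₀ ∘ X) (𝓝 p) = 𝓝 (proj₀ (X p)) := by
  have hps := mem_chart_source ℂ p
  have hmap := (hX.spacelikeAt_comp_chartAt_symm hp).map_nhds_proj₀_comp
    ((hX.contDiffAt_comp_chartAt_symm p).of_le one_le_two)
  rw [← (chartAt ℂ p).symm_map_nhds_eq hps, map_map]
  simpa only [Function.comp_def, (chartAt ℂ p).left_inv hps] using hmap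

theorem exists_lt_one_eventually_abs_sub_le (hX : IsConformalMaximalImmersion M X)
    (hp : p ∈ M.int) :
    ∃ κ < (1 : ℝ), ∀ᶠ q in 𝓝 p, |X q 2 - X p 2| ≤ κ * ‖proj₀ (X q) - proj₀ (X p)‖ := by
  have hps := mem_chart_source ℂ p
  obtain ⟨κ, hκ, hle⟩ := (hX.spacelikeAt_comp_chartAt_symm hp).exists_lt_one_eventually_abs_sub_le
    ((hX.contDiffAt_comp_chartAt_symm p).differentiableAt two_ne_zero)
  refine ⟨κ, hκ, ?_⟩
  rw [← (chartAt ℂ p).symm_map_nhds_eq hps, eventually_map]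
  simpa only [Function.comp_def, (chartAt ℂ p).left_inv hps] using hle

variable [T2Space R]

theorem not_isLocalMax_sub_smul_comp_lorentz_self (hX : IsConformalMaximalImmersion M X)
    (hp : p ∈ M.int) {f : R → ℝ} (hf : HarmonicOnSurface f M.int) {φ : ℝ → ℝ}
    (hφ : ContDiffAt ℝ 2 φ (lorentz (X p) (X p)))
    (hconcave : deriv (deriv φ) (lorentz (X p) (X p)) ≤ 0)
    (hlog : deriv φ (lorentz (X p) (X p)) +
      lorentz (X p) (X p) * deriv (deriv φ) (lorentz (X p) (X p)) < 0) {ε : ℝ} (hε : 0 < ε) :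
    ¬ IsLocalMax (fun q => f q - ε • φ (lorentz (X q) (X q))) p := by
  intro hmax
  have hleft : (chartAt ℂ p).symm (chartAt ℂ p p) = p :=
    (chartAt ℂ p).left_inv (mem_chart_source ℂ p)
  set Y := X ∘ (chartAt ℂ p).symm
  have hYp : Y (chartAt ℂ p p) = X p := congrArg X hleft
  have hY : ContDiffAt ℝ 2 Y (chartAt ℂ p p) := hX.contDiffAt_comp_chartAt_symm p
  have hsp := hX.spacelikeAt_comp_chartAt_symm hp
  have hiso : ∀ᶠ w in 𝓝 (chartAt ℂ p p), IsothermalAt Y w :=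
    (eventually_chartAt_symm_mem M.isOpen_int hp).mono fun w hw =>
      hX.conformal _ (chart_mem_atlas ℂ p) w hw.1 hw.2
  have hΔ : Δ Y (chartAt ℂ p p) = 0 := laplacian_eq_zero_of_meanCurvature_eq_zero hY hiso hsp
    (hX.maximal _ (chart_mem_atlas ℂ p) _ (mem_chart_target ℂ p) (by rwa [hleft]))
  have hharm : HarmonicAt (f ∘ (chartAt ℂ p).symm) (chartAt ℂ p p) :=
    hf _ (chart_mem_atlas ℂ p) _ ⟨mem_chart_target ℂ p, by rwa [mem_preimage, hleft]⟩
  rw [← hYp] at hφ hconcave hlog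
  have hψ : ContDiffAt ℝ 2 (fun w => lorentz (Y w) (Y w)) (chartAt ℂ p p) :=
    contDiff_lorentz.contDiffAt.comp _ (hY.prodMk hY)
  exact not_isLocalMax_sub_smul_of_laplacian_neg hharm
    (ContDiffAt.comp (f := fun w => lorentz (Y w) (Y w)) _ hφ hψ)
    (laplacian_comp_lorentz_self_neg hY hiso.self_of_nhds hsp hΔ hφ hconcave hlog) hε
    (isLocalMax_comp_chartAt_symm hmax)

end IsConformalMaximalImmersion

section Graph

variable {Ω : Set ℂ} {u : ℂ → ℝ}

theorem mem_and_eq_of_image_prodEquiv_eq (hu : prodEquiv '' (X '' M.carrier) = Ω.graphOn u) {p : R}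
    (hp : p ∈ M.carrier) : proj₀ (X p) ∈ Ω ∧ u (proj₀ (X p)) = X p 2 := by
  have hmem : prodEquiv (X p) ∈ Ω.graphOn u :=
    hu ▸ mem_image_of_mem prodEquiv (mem_image_of_mem X hp)
  exact mem_graphOn.1 hmem

theorem graphOn_sdiff_subset (hu : prodEquiv '' (X '' M.carrier) = Ω.graphOn u) :
    (Ω \ (proj₀ ∘ X) '' M.int).graphOn u ⊆ prodEquiv '' (X '' M.boundary) := by
  rintro _ ⟨ζ, ⟨hζ, hint⟩, rfl⟩
  obtain ⟨_, ⟨p, hp, rfl⟩, hpζ⟩ := hu.symm.subset (mem_image_of_mem (fun ζ => (ζ, u ζ)) hζ)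
  refine ⟨X p, mem_image_of_mem X ?_, hpζ⟩
  by_contra hpb
  exact hint ⟨p, ⟨hp, hpb⟩, congrArg Prod.fst hpζ⟩

variable [T2Space R]

theorem IsConformalMaximalImmersion.isOpen_image_proj₀ (hX : IsConformalMaximalImmersion M X) :
    IsOpen ((proj₀ ∘ X) '' M.int) := by
  refine isOpen_iff_mem_nhds.2 ?_
  rintro _ ⟨p, hp, rfl⟩
  rw [Function.comp_apply, ← hX.map_nhds_proj₀_comp hp]
  exact image_mem_map (M.isOpen_int.mem_nhds hp)

theorem IsConformalMaximalImmersion.exists_lt_one_eventually_dist_le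
    (hX : IsConformalMaximalImmersion M X) (hu : prodEquiv '' (X '' M.carrier) = Ω.graphOn u)
    {p : R} (hp : p ∈ M.int) :
    ∃ κ < (1 : ℝ), ∀ᶠ ζ in 𝓝 (proj₀ (X p)),
      dist (u ζ) (u (proj₀ (X p))) ≤ κ * dist ζ (proj₀ (X p)) := by
  obtain ⟨κ, hκ, hle⟩ := hX.exists_lt_one_eventually_abs_sub_le hp
  refine ⟨κ, hκ, ?_⟩
  rw [← hX.map_nhds_proj₀_comp hp, eventually_map]
  filter_upwards [hle, M.isOpen_int.mem_nhds hp] with q hq hqM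
  rwa [Function.comp_apply, (mem_and_eq_of_image_prodEquiv_eq hu hqM.1).2,
    (mem_and_eq_of_image_prodEquiv_eq hu hp.1).2, Real.dist_eq, dist_eq_norm]

theorem IsConformalMaximalImmersion.dist_le_of_starConvex (hX : IsConformalMaximalImmersion M X)
    (hproper : IsProperMap (M.carrier.domRestrict X))
    (hu : prodEquiv '' (X '' M.carrier) = Ω.graphOn u) {z₀ v : ℂ} (hΩ : StarConvex ℝ z₀ Ω)
    {t : ℝ} (ht : 0 < t) (ht1 : t ≤ 1) (hv : z₀ + v ∈ (proj₀ ∘ X) '' M.int)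
    (htv : z₀ + t • v ∈ (proj₀ ∘ X) '' M.int) :
    dist (u (z₀ + t • v)) (u (z₀ + v)) ≤ ‖v‖ * (1 - t) := by
  have hclosed : IsClosed (X '' M.carrier) := by
    simpa only [range_domRestrict] using hproper.isClosedMap.isClosed_range
  have hgraph : IsClosed (Ω.graphOn u) := hu ▸ prodEquiv.toHomeomorph.isClosedMap _ hclosed
  refine _root_.MaximalSurface.dist_le_of_starConvex hgraph hΩ hX.isOpen_image_proj₀ ?_ ?_ ?_ ht
    ht1 hv htv
  · rintro _ ⟨p, hp, rfl⟩
    exact (mem_and_eq_of_image_prodEquiv_eq hu hp.1).1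
  · rintro _ ⟨p, hp, rfl⟩
    obtain ⟨κ, hκ, hle⟩ := hX.exists_lt_one_eventually_dist_le hu hp
    exact hle.mono fun ζ hζ => hζ.trans (mul_le_of_le_one_left dist_nonneg hκ.le)
  · calc dimH ((Ω \ (proj₀ ∘ X) '' M.int).graphOn u)
        ≤ dimH (prodEquiv '' (X '' M.boundary)) := dimH_mono (graphOn_sdiff_subset hu)
      _ = dimH (X '' M.boundary) := prodEquiv.dimH_image _
      _ ≤ 1 := BorderedSurface.dimH_image_boundary_le (hX.smooth.of_le ENat.LEInfty.out) hproper
      _ < 2 := by norm_num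

end Graph

end Immersion

section Cone

/-- The region outside the light cone of the origin whose vertical distance to that cone is at least
`δ`. -/
def spacelikeCone (δ : ℝ) : Set E3 := {x | |x 2| ≤ ‖proj₀ x‖ - δ}

variable {δ : ℝ}

theorem isClosed_spacelikeCone (δ : ℝ) : IsClosed (spacelikeCone δ) :=
  isClosed_le (by fun_prop) (continuous_proj₀.norm.sub continuous_const)

theorem le_norm_proj₀_of_mem_spacelikeCone {x : E3} (hx : x ∈ spacelikeCone δ) : δ ≤ ‖proj₀ x‖ :=
  sub_nonneg.1 ((abs_nonneg _).trans hx)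

theorem mul_norm_proj₀_le_lorentz_self (hδ : 0 ≤ δ) {x : E3} (hx : x ∈ spacelikeCone δ) :
    δ * ‖proj₀ x‖ ≤ lorentz x x := by
  have hsq : x 2 ^ 2 ≤ (‖proj₀ x‖ - δ) ^ 2 := sq_le_sq' (abs_le.1 hx).1 (abs_le.1 hx).2
  have hδx := mul_le_mul_of_nonneg_left (le_norm_proj₀_of_mem_spacelikeCone hx) hδ
  rw [lorentz_self]
  linarith

theorem sq_le_lorentz_self (hδ : 0 ≤ δ) {x : E3} (hx : x ∈ spacelikeCone δ) :
    δ ^ 2 ≤ lorentz x x := by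
  rw [sq]
  exact (mul_le_mul_of_nonneg_left (le_norm_proj₀_of_mem_spacelikeCone hx) hδ).trans
    (mul_norm_proj₀_le_lorentz_self hδ hx)

theorem isCompact_spacelikeCone_inter (hδ : 0 < δ) (T : ℝ) :
    IsCompact (spacelikeCone δ ∩ {x | lorentz x x ≤ T}) := by
  have hclosed : IsClosed (spacelikeCone δ ∩ {x | lorentz x x ≤ T}) :=
    (isClosed_spacelikeCone δ).inter (isClosed_le (by unfold lorentz; fun_prop) continuous_const)
  refine (prodEquiv.toHomeomorph.isCompact_preimage.2
    ((isCompact_closedBall 0 (T / δ)).prod (isCompact_closedBall 0 (T / δ)))).of_isClosed_subset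
    hclosed fun x ⟨hx, hxT⟩ => ?_
  have hproj : ‖proj₀ x‖ ≤ T / δ :=
    (le_div_iff₀' hδ).2 ((mul_norm_proj₀_le_lorentz_self hδ.le hx).trans hxT)
  have hheight : ‖x 2‖ ≤ T / δ := (hx.trans (sub_le_self _ hδ.le)).trans hproj
  exact ⟨mem_closedBall_zero_iff.2 hproj, mem_closedBall_zero_iff.2 hheight⟩

end Cone

section LogLog

/-- An increasing unbounded function on `[c, ∞)` which is strictly concave as a function of `log t`;
composed with the Lorentzian square norm it is the barrier at infinity. -/
noncomputable def logLog (c t : ℝ) : ℝ := Real.log (1 + Real.log (t / c))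

variable {c t : ℝ}

theorem one_le_one_add_log_div (hc : 0 < c) (ht : c ≤ t) : 1 ≤ 1 + Real.log (t / c) :=
  le_add_of_nonneg_right (Real.log_nonneg ((one_le_div hc).2 ht))

theorem logLog_nonneg (hc : 0 < c) (ht : c ≤ t) : 0 ≤ logLog c t :=
  Real.log_nonneg (one_le_one_add_log_div hc ht)

theorem logLog_le_iff (hc : 0 < c) (ht : c ≤ t) {T : ℝ} :
    logLog c t ≤ T ↔ t ≤ c * Real.exp (Real.exp T - 1) := by
  rw [logLog, Real.log_le_iff_le_exp (one_pos.trans_le (one_le_one_add_log_div hc ht)),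
    ← le_sub_iff_add_le', Real.log_le_iff_le_exp (div_pos (hc.trans_le ht) hc), div_le_iff₀' hc]

theorem contDiffAt_logLog (hc : 0 < c) (ht : c ≤ t) {n : WithTop ℕ∞} :
    ContDiffAt ℝ n (logLog c) t := by
  have hlog : ContDiffAt ℝ n (fun s => Real.log (s / c)) t :=
    (contDiffAt_id.div_const c).log (div_pos (hc.trans_le ht) hc).ne'
  exact (contDiffAt_const.add hlog).log (one_pos.trans_le (one_le_one_add_log_div hc ht)).ne'

theorem hasDerivAt_one_add_log_div (hc : c ≠ 0) (ht : t ≠ 0) :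
    HasDerivAt (fun s => 1 + Real.log (s / c)) t⁻¹ t :=
  ((((hasDerivAt_id t).div_const c).log (div_ne_zero ht hc)).const_add 1).congr_deriv
    (by rw [id, div_div_div_cancel_right₀ hc, one_div])

theorem deriv_logLog_eventuallyEq (hc : 0 < c) (ht : c ≤ t) :
    deriv (logLog c) =ᶠ[𝓝 t] fun s => (s * (1 + Real.log (s / c)))⁻¹ := by
  have ht0 : t ≠ 0 := (hc.trans_le ht).ne'
  have hL0 : 1 + Real.log (t / c) ≠ 0 := (one_pos.trans_le (one_le_one_add_log_div hc ht)).ne'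
  filter_upwards [eventually_ne_nhds ht0,
    (hasDerivAt_one_add_log_div hc.ne' ht0).continuousAt.eventually_ne hL0] with s hs hsL
  rw [mul_inv, ← div_eq_mul_inv]
  exact ((hasDerivAt_one_add_log_div hc.ne' hs).log hsL).deriv

theorem deriv_deriv_logLog (hc : 0 < c) (ht : c ≤ t) :
    deriv (deriv (logLog c)) t =
      -(2 + Real.log (t / c)) / (t * (1 + Real.log (t / c))) ^ 2 := by
  have ht0 : t ≠ 0 := (hc.trans_le ht).ne'
  have hL0 : 1 + Real.log (t / c) ≠ 0 := (one_pos.trans_le (one_le_one_add_log_div hc ht)).ne'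
  rw [(deriv_logLog_eventuallyEq hc ht).deriv_eq]
  refine (((hasDerivAt_id t).mul (hasDerivAt_one_add_log_div hc.ne' ht0)).inv
    (mul_ne_zero ht0 hL0)).deriv.trans ?_
  simp only [Pi.mul_apply, id, mul_inv_cancel₀ ht0]
  ring

theorem deriv_deriv_logLog_nonpos (hc : 0 < c) (ht : c ≤ t) :
    deriv (deriv (logLog c)) t ≤ 0 := by
  rw [deriv_deriv_logLog hc ht]
  exact div_nonpos_of_nonpos_of_nonneg (by linarith [one_le_one_add_log_div hc ht]) (sq_nonneg _)

theorem deriv_logLog_add_mul_deriv_deriv_neg (hc : 0 < c) (ht : c ≤ t) :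
    deriv (logLog c) t + t * deriv (deriv (logLog c)) t < 0 := by
  have ht0 : 0 < t := hc.trans_le ht
  have hL0 : 0 < 1 + Real.log (t / c) := one_pos.trans_le (one_le_one_add_log_div hc ht)
  have hsum : deriv (logLog c) t + t * deriv (deriv (logLog c)) t =
      -(t * (1 + Real.log (t / c)) ^ 2)⁻¹ := by
    rw [(deriv_logLog_eventuallyEq hc ht).eq_of_nhds, deriv_deriv_logLog hc ht]
    field_simp
    ring
  rw [hsum, neg_lt_zero]
  positivity

end LogLog

section MaximumPrinciple

variable {R : Type*} [TopologicalSpace R]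

theorem le_of_forall_not_isMaxOn_sub_smul {N B : Set R} {f b : R → ℝ} {C m : ℝ}
    (hf : ContinuousOn f N) (hb : ContinuousOn b N) (hC : ∀ p ∈ N, f p ≤ C)
    (hb0 : ∀ p ∈ N, 0 ≤ b p) (hcompact : ∀ T, IsCompact (N ∩ {p | b p ≤ T}))
    (hB : ∀ p ∈ N ∩ B, f p ≤ m)
    (hmax : ∀ ε : ℝ, 0 < ε → ∀ p ∈ N \ B, ¬ IsMaxOn (fun q => f q - ε • b q) N p) {p : R}
    (hp : p ∈ N) : f p ≤ m := by
  suffices hle : ∀ ε : ℝ, 0 < ε → f p - ε • b p ≤ m by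
    have hlim : Tendsto (fun ε : ℝ => f p - ε • b p) (𝓝[>] 0) (𝓝 (f p)) :=
      tendsto_nhdsWithin_of_tendsto_nhds (Continuous.tendsto' (by fun_prop) _ _ (by simp))
    exact le_of_tendsto hlim (eventually_mem_nhdsWithin.mono hle)
  intro ε hε
  by_contra! hlt
  set T := max (b p) ((C - m) / ε)
  have hpT : p ∈ N ∩ {p | b p ≤ T} := ⟨hp, le_max_left (b p) _⟩
  obtain ⟨q, ⟨hqN, -⟩, hqmax⟩ := (hcompact T).exists_isMaxOn ⟨p, hpT⟩
    ((hf.sub (hb.const_smul ε)).mono inter_subset_left)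
  have hpq : f p - ε • b p ≤ f q - ε • b q := hqmax hpT
  have hqB : q ∉ B := fun hqB => by
    linarith [hB q ⟨hqN, hqB⟩, smul_nonneg hε.le (hb0 q hqN)]
  refine hmax ε hε q ⟨hqN, hqB⟩ fun s hs => ?_
  rcases le_or_gt (b s) T with hsT | hsT
  · exact hqmax ⟨hs, hsT⟩
  · have hbs : C - m < ε • b s := (div_lt_iff₀' hε).1 ((le_max_right _ _).trans_lt hsT)
    rw [mem_ofPred_eq]
    linarith [hC s hs]

variable [T2Space R] [ChartedSpace ℂ R] {M : BorderedSurface R} {f : R → ℝ} {m : ℝ}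

theorem BorderedSurface.le_of_isMaxOn (hM : M.boundary.Nonempty) (hfc : ContinuousOn f M.carrier)
    (hfh : HarmonicOnSurface f M.int) (hm : ∀ p ∈ M.boundary, f p ≤ m) {q : R}
    (hq : q ∈ M.carrier) (hmax : IsMaxOn f M.carrier q) : f q ≤ m := by
  by_contra! hlt
  have hint : ∀ s ∈ M.carrier, f s = f q → s ∈ M.int := fun s hs hsq =>
    ⟨hs, fun hb => (hm s hb).not_gt (hsq ▸ hlt)⟩
  set A : Set R := {s | s ∈ M.int ∧ f s = f q}
  have hAopen : IsOpen A := by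
    refine isOpen_iff_mem_nhds.2 fun s ⟨hs, hsq⟩ => ?_
    have hsM := M.isOpen_int.mem_nhds hs
    have hsmax : IsLocalMax f s := by
      filter_upwards [hsM] with s' hs'
      exact hsq ▸ hmax hs'.1
    filter_upwards [hsM, hfh.eventually_eq_of_isLocalMax M.isOpen_int hs hsmax] with s' hs' hs's
    exact ⟨hs', hs's.trans hsq⟩
  have hsub : M.carrier ⊆ A := by
    refine M.isConnected.isPreconnected.subset_of_closure_inter_subset hAopen
      ⟨q, hq, hint q hq rfl, rfl⟩ fun s ⟨hsA, hsM⟩ => ?_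
    have hsq : f s ∈ closure {f q} :=
      ((hfc s hsM).mono fun _ h => h.1.1).mem_closure hsA fun _ h => h.2
    rw [closure_singleton] at hsq
    exact ⟨hint s hsM hsq, hsq⟩
  obtain ⟨b, hb⟩ := hM
  exact (hsub (M.boundary_subset hb)).1.2 hb

variable {X : R → E3}

theorem IsConformalMaximalImmersion.le_of_forall_mem_spacelikeCone
    (hX : IsConformalMaximalImmersion M X) (hproper : IsProperMap (M.carrier.domRestrict X))
    {δ : ℝ} (hδ : 0 < δ) {K : Set R} (hK : IsClosed K)
    (hcone : ∀ p ∈ M.carrier \ K, X p ∈ spacelikeCone δ) (hfc : ContinuousOn f M.carrier)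
    (hfh : HarmonicOnSurface f M.int) {C : ℝ} (hC : ∀ p ∈ M.carrier, f p ≤ C)
    (hm : ∀ p ∈ M.boundary, f p ≤ m) (hmK : ∀ p ∈ K, f p ≤ m) {p : R} (hp : p ∈ M.carrier) :
    f p ≤ m := by
  by_cases hpK : p ∈ K
  · exact hmK p hpK
  have hXc : Continuous X := hX.smooth.continuous
  have hδ2 : 0 < δ ^ 2 := pow_pos hδ 2
  have hψ : ∀ q ∈ M.carrier ∩ X ⁻¹' spacelikeCone δ, δ ^ 2 ≤ lorentz (X q) (X q) := fun q hq =>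
    sq_le_lorentz_self hδ.le hq.2
  refine le_of_forall_not_isMaxOn_sub_smul (N := M.carrier ∩ X ⁻¹' spacelikeCone δ)
    (B := M.boundary ∪ K) (b := fun q => logLog (δ ^ 2) (lorentz (X q) (X q)))
    (hfc.mono inter_subset_left) (fun q hq => ?_) (fun q hq => hC q hq.1)
    (fun q hq => logLog_nonneg hδ2 (hψ q hq)) (fun T => ?_)
    (fun q hq => hq.2.elim (hm q) (hmK q)) (fun ε hε q hq hmax => ?_) ⟨hp, hcone p ⟨hp, hpK⟩⟩
  · have hnorm : Continuous fun q => lorentz (X q) (X q) :=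
      (contDiff_lorentz (n := 0)).continuous.comp (hXc.prodMk hXc)
    exact (ContinuousAt.comp (f := fun q => lorentz (X q) (X q))
      (contDiffAt_logLog (n := 0) hδ2 (hψ q hq)).continuousAt
      hnorm.continuousAt).continuousWithinAt
  · convert isCompact_inter_preimage hproper (isCompact_spacelikeCone_inter hδ
      (δ ^ 2 * Real.exp (Real.exp T - 1))) using 1
    rw [preimage_inter, ← inter_assoc]
    ext q
    exact and_congr_right fun hq => logLog_le_iff hδ2 (hψ q hq)
  · have hqI : q ∈ M.int := ⟨hq.1.1, fun h => hq.2 (Or.inl h)⟩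
    have hqK : q ∈ Kᶜ := fun h => hq.2 (Or.inr h)
    refine hX.not_isLocalMax_sub_smul_comp_lorentz_self hqI hfh (contDiffAt_logLog hδ2 (hψ q hq.1))
      (deriv_deriv_logLog_nonpos hδ2 (hψ q hq.1))
      (deriv_logLog_add_mul_deriv_deriv_neg hδ2 (hψ q hq.1)) hε ?_
    filter_upwards [M.isOpen_int.mem_nhds hqI, hK.isOpen_compl.mem_nhds hqK] with s hsI hsK
    exact hmax ⟨hsI.1, hcone s ⟨hsI.1, hsK⟩⟩

end MaximumPrinciple

section Starlike

variable {R : Type*} [TopologicalSpace R] [T2Space R] [ChartedSpace ℂ R] {M : BorderedSurface R}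
  {X : R → E3} {Ω : Set ℂ} {u : ℂ → ℝ}

theorem IsConformalMaximalImmersion.dist_le_add_of_starConvex
    (hX : IsConformalMaximalImmersion M X) (hproper : IsProperMap (M.carrier.domRestrict X))
    (hu : prodEquiv '' (X '' M.carrier) = Ω.graphOn u) {z₀ : ℂ} (hΩ : StarConvex ℝ z₀ Ω)
    {r c : ℝ} (hr : 0 < r) (hint : Metric.sphere z₀ r ⊆ (proj₀ ∘ X) '' M.int)
    (hc : ∀ ζ ∈ Metric.sphere z₀ r, dist (u ζ) (u z₀) ≤ c) {ζ : ℂ} (hζ : ζ ∈ (proj₀ ∘ X) '' M.int)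
    (hrζ : r ≤ dist ζ z₀) : dist (u ζ) (u z₀) ≤ dist ζ z₀ - r + c := by
  obtain ⟨v, rfl⟩ : ∃ v, z₀ + v = ζ := ⟨ζ - z₀, add_sub_cancel z₀ ζ⟩
  rw [dist_self_add_left] at hrζ ⊢
  have hv : 0 < ‖v‖ := hr.trans_le hrζ
  have hsphere : z₀ + (r / ‖v‖) • v ∈ Metric.sphere z₀ r := by
    rw [Metric.mem_sphere, dist_self_add_left, norm_smul, norm_div, norm_norm,
      Real.norm_of_nonneg hr.le, div_mul_cancel₀ _ hv.ne']
  have hradial := hX.dist_le_of_starConvex hproper hu hΩ (div_pos hr hv) ((div_le_one hv).2 hrζ) hζ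
    (hint hsphere)
  rw [mul_sub, mul_one, mul_div_cancel₀ _ hv.ne', dist_comm] at hradial
  exact (dist_triangle _ _ _).trans (add_le_add hradial (hc _ hsphere))

theorem IsConformalMaximalImmersion.sub_mem_spacelikeCone_of_starConvex
    (hX : IsConformalMaximalImmersion M X) (hproper : IsProperMap (M.carrier.domRestrict X))
    (hu : prodEquiv '' (X '' M.carrier) = Ω.graphOn u) {p₀ : R} (hp₀ : p₀ ∈ M.carrier)
    (hΩ : StarConvex ℝ (proj₀ (X p₀)) Ω) {r δ : ℝ} (hr : 0 < r)
    (hint : Metric.sphere (proj₀ (X p₀)) r ⊆ (proj₀ ∘ X) '' M.int)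
    (hδ : ∀ ζ ∈ Metric.sphere (proj₀ (X p₀)) r, dist (u ζ) (u (proj₀ (X p₀))) ≤ r - δ) {p : R}
    (hp : p ∈ M.carrier) (hrp : r < dist (proj₀ (X p)) (proj₀ (X p₀))) :
    X p - X p₀ ∈ spacelikeCone δ := by
  have hXc : Continuous X := hX.smooth.continuous
  have hmem : p ∈ closure ({q | r < dist (proj₀ (X q)) (proj₀ (X p₀))} ∩ M.int) :=
    (isOpen_lt continuous_const ((continuous_proj₀.comp hXc).dist continuous_const)).inter_closure
      ⟨hrp, M.interior_dense hp⟩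
  refine ((isClosed_spacelikeCone δ).preimage
    (hXc.sub continuous_const)).closure_subset_iff.2 ?_ hmem
  rintro q ⟨hqr, hq⟩
  have hle := hX.dist_le_add_of_starConvex hproper hu hΩ hr hint hδ (mem_image_of_mem _ hq) hqr.le
  rw [Function.comp_apply, (mem_and_eq_of_image_prodEquiv_eq hu hq.1).2,
    (mem_and_eq_of_image_prodEquiv_eq hu hp₀).2, sub_add_sub_cancel, Real.dist_eq,
    dist_eq_norm] at hle
  rwa [mem_preimage, spacelikeCone, mem_ofPred_eq, Pi.sub_apply, proj₀_sub, PiLp.sub_apply]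

theorem IsConformalMaximalImmersion.exists_isCompact_forall_sub_mem_spacelikeCone
    (hX : IsConformalMaximalImmersion M X) (hproper : IsProperMap (M.carrier.domRestrict X))
    (hgraph : IsGraphOver (X '' M.carrier) Ω) {p₀ : R} (hp₀ : p₀ ∈ M.int)
    (hΩ : StarConvex ℝ (proj₀ (X p₀)) Ω) :
    ∃ δ > 0, ∃ K ⊆ M.carrier, IsCompact K ∧ p₀ ∈ K ∧
      ∀ p ∈ M.carrier \ K, X p - X p₀ ∈ spacelikeCone δ := by
  obtain ⟨u, hu⟩ := hgraph.exists_image_prodEquiv_eq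
  obtain ⟨κ, hκ, hlip⟩ := hX.exists_lt_one_eventually_dist_le hu hp₀
  obtain ⟨r, hr, hball⟩ := Metric.nhds_basis_closedBall.eventually_iff.1
    (hlip.and (hX.isOpen_image_proj₀.mem_nhds (mem_image_of_mem _ hp₀)))
  have hheight : ∀ ζ ∈ Metric.closedBall (proj₀ (X p₀)) r, dist (u ζ) (u (proj₀ (X p₀))) ≤ r :=
    fun ζ hζ => ((hball hζ).1.trans (mul_le_of_le_one_left dist_nonneg hκ.le)).trans hζ
  refine ⟨(1 - κ) * r, mul_pos (sub_pos.2 hκ) hr,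
    M.carrier ∩ X ⁻¹' (prodEquiv ⁻¹' (Metric.closedBall (prodEquiv (X p₀)) r)), inter_subset_left,
    isCompact_inter_preimage hproper
      (prodEquiv.toHomeomorph.isCompact_preimage.2 (isCompact_closedBall _ r)),
    ⟨hp₀.1, Metric.mem_closedBall_self hr.le⟩, fun p ⟨hp, hpK⟩ => ?_⟩
  refine hX.sub_mem_spacelikeCone_of_starConvex hproper hu hp₀.1 hΩ hr
    (fun ζ hζ => (hball (Metric.sphere_subset_closedBall hζ)).2) (fun ζ hζ => ?_) hp ?_
  · refine (hball (Metric.sphere_subset_closedBall hζ)).1.trans_eq ?_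
    rw [Metric.mem_sphere.1 hζ]
    ring
  · by_contra! hle
    refine hpK ⟨hp, max_le hle ?_⟩
    have := hheight _ hle
    rwa [(mem_and_eq_of_image_prodEquiv_eq hu hp).2,
      (mem_and_eq_of_image_prodEquiv_eq hu hp₀.1).2] at this

end Starlike

section RelativeParabolicity

variable {R : Type*} [TopologicalSpace R] [ChartedSpace ℂ R] {M : BorderedSurface R}

/-- The Phragmén–Lindelöf maximum principle, a one-sided strengthening of relative parabolicity: a
function that is continuous and bounded above on `M`, and harmonic on `Int(M)`, is bounded on `M` by
each of its upper bounds on `∂M`. -/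
def BorderedSurface.MaximumPrinciple (M : BorderedSurface R) : Prop :=
  ∀ f : R → ℝ, ContinuousOn f M.carrier → HarmonicOnSurface f M.int → BddAbove (f '' M.carrier) →
    ∀ m : ℝ, (∀ p ∈ M.boundary, f p ≤ m) → ∀ p ∈ M.carrier, f p ≤ m

theorem BorderedSurface.MaximumPrinciple.relativeParabolic (hM : M.MaximumPrinciple) :
    M.RelativeParabolic := by
  rintro f hfc hfh ⟨C, hC⟩ hf0 p hp
  refine le_antisymm (hM f hfc hfh ⟨C, ?_⟩ 0 (fun q hq => (hf0 q hq).le) p hp)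
    (neg_nonpos.1 (hM (-f) hfc.neg hfh.neg ⟨C, ?_⟩ 0 (fun q hq => ?_) p hp))
  · exact forall_mem_image.2 fun q hq => (abs_le.1 (hC q hq)).2
  · exact forall_mem_image.2 fun q hq => neg_le.1 (abs_le.1 (hC q hq)).1
  · rw [Pi.neg_apply, hf0 q hq, neg_zero]

end RelativeParabolicity

end MaximalSurface

theorem mainTheorem2_general {R : Type*} [TopologicalSpace R] [T2Space R] [ChartedSpace ℂ R]
    (M : MaximalSurface.BorderedSurface R) (hM : M.boundary.Nonempty)
    (X : R → MaximalSurface.E3) (hX : MaximalSurface.IsConformalMaximalImmersion M X)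
    (hproper : IsProperMap (M.carrier.domRestrict X))
    (Ω : Set ℂ) (hgraph : MaximalSurface.IsGraphOver (X '' M.carrier) Ω)
    (p₀ : R) (hp₀ : p₀ ∈ M.int) (hstar : StarConvex ℝ (MaximalSurface.proj₀ (X p₀)) Ω) :
    M.MaximumPrinciple := by
  intro f hfc hfh ⟨C, hC⟩ m hm p hp
  obtain ⟨δ, hδ, K, hKM, hK, hp₀K, hcone⟩ :=
    hX.exists_isCompact_forall_sub_mem_spacelikeCone hproper hgraph hp₀ hstar
  obtain ⟨q, hq, hqmax⟩ := hK.exists_isMaxOn ⟨p₀, hp₀K⟩ (hfc.mono hKM)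
  have hproper' : IsProperMap (M.carrier.domRestrict fun p => X p - X p₀) :=
    (Homeomorph.subRight (X p₀)).isProperMap.comp hproper
  have hle : ∀ s ∈ M.carrier, f s ≤ max (f q) m := fun s hs =>
    (hX.sub_const (X p₀)).le_of_forall_mem_spacelikeCone hproper' hδ hK.isClosed hcone hfc hfh
      (fun _ h => hC (Set.mem_image_of_mem f h)) (fun b hb => le_max_of_le_right (hm b hb))
      (fun _ h => le_max_of_le_left (hqmax h)) hs
  refine (hle p hp).trans (max_le ?_ le_rfl)
  by_contra! hlt
  rw [max_eq_left hlt.le] at hle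
  exact hlt.not_ge (M.le_of_isMaxOn hM hfc hfh hm (hKM hq) hle)

theorem mainTheorem2 {R : Type*} [TopologicalSpace R] [T2Space R] [ChartedSpace ℂ R]
    [IsManifold 𝓘(ℂ, ℂ) ω R]
    (M : MaximalSurface.BorderedSurface R) (hM : M.boundary.Nonempty)
    (X : R → MaximalSurface.E3) (hX : MaximalSurface.IsConformalMaximalImmersion M X)
    (hproper : IsProperMap (M.carrier.domRestrict X))
    (Ω : Set ℂ) (hΩ : IsClosed Ω) (hgraph : MaximalSurface.IsGraphOver (X '' M.carrier) Ω)
    (p₀ : R) (hp₀ : p₀ ∈ M.int) (hstar : StarConvex ℝ (MaximalSurface.proj₀ (X p₀)) Ω) :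
    M.RelativeParabolic :=
  (mainTheorem2_general M hM X hX hproper Ω hgraph p₀ hp₀ hstar).relativeParabolic
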